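/- Let $d\ge 0$, and let $g:\mathbb R^d\to\mathbb R$ be non-negative and continuously differentiable with $\|\nabla g(\theta)-\nabla g(\theta')\|\le L\|\theta-\theta'\|$ for all $\theta,\theta'\in\mathbb R^d$, where $L\ge 0$. Let $\xi_1,\xi_2,\dots$ be independent random variables on a probability space, with values in a measurable space $\Xi$. Fix $\alpha_0>0$, $S_0>0$ and $\theta_1\in\mathbb R^d$, let $\nabla g(\cdot,\cdot):\mathbb R^d\times\Xi\to\mathbb R^d$ be a measurable stochastic gradient oracle, and let AdaGrad-Norm generate, for $n\ge 1$, $$S_n=S_{n-1}+\|\nabla g(\theta_n,\xi_n)\|^2,\qquad \theta_{n+1}=\theta_n-\frac{\alpha_0}{\sqrt{S_n}}\,\nabla g(\theta_n,\xi_n).$$ Put $\mathscr F_n=\sigma(\xi_1,\dots,\xi_n)$ ($\mathscr F_0$ trivial), and suppose that for some constants $\sigma_0,\sigma_1\ge 0$ and all $n\ge 1$ the vector $\nabla g(\theta_n,\xi_n)$ is square-integrable and, almost surely, $$\mathbb E[\nabla g(\theta_n,\xi_n)\mid\mathscr F_{n-1}]=\nabla g(\theta_n),\qquad \mathbb E[\|\nabla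 g(\theta_n,\xi_n)\|^2\mid\mathscr F_{n-1}]\le\sigma_0\|\nabla g(\theta_n)\|^2+\sigma_1 .$$ Then there is a constant $C>0$, depending only on $L,\sigma_0,\sigma_1,\alpha_0,S_0$ and $g(\theta_1)$, such that for every integer $T\ge 2$ and every $\delta\in(0,1)$, with probability at least $1-\delta$, $$\frac1T\sum_{n=1}^{T}\|\nabla g(\theta_n)\|^2\le\frac{C}{\delta}\cdot\frac{\ln T}{\sqrt T}\qquad\text{and}\qquad \min_{1\le n\le T}\|\nabla g(\theta_n)\|^2\le\frac{C}{\delta}\cdot\frac{\ln T}{\sqrt T}.$$ -/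

import Mathlib

open MeasureTheory ProbabilityTheory

noncomputable section

/-- The state of AdaGrad-Norm run on a realised noise sequence `x 1, x 2, …`:
`adaGradState G α₀ S₀ θ₁ x n` is the pair `(θ_{n+1}, S_n)`.  The map `G θ ξ` is the stochastic
gradient returned by the oracle at the point `θ` for the noise value `ξ`.  The run starts from
`(θ_1, S_0) = (θ₁, S₀)`, and the step with noise value `ξ = x (n + 1)` first updates the
accumulator and then takes a step of size `α₀ / √S` with the *updated* accumulator. -/
def adaGradState {d : ℕ} {Ξ : Type*}
    (G : EuclideanSpace ℝ (Fin d) → Ξ → EuclideanSpace ℝ (Fin d)) (α₀ S₀ : ℝ)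
    (θ₁ : EuclideanSpace ℝ (Fin d)) (x : ℕ → Ξ) : ℕ → EuclideanSpace ℝ (Fin d) × ℝ
  | 0 => (θ₁, S₀)
  | n + 1 =>
    let θ := (adaGradState G α₀ S₀ θ₁ x n).1
    let S := (adaGradState G α₀ S₀ θ₁ x n).2 + ‖G θ (x (n + 1))‖ ^ 2
    (θ - (α₀ / √S) • G θ (x (n + 1)), S)

/-- The iterate `θ_n` of AdaGrad-Norm, for `n ≥ 1`. -/
def adaGradIter {d : ℕ} {Ξ : Type*}
    (G : EuclideanSpace ℝ (Fin d) → Ξ → EuclideanSpace ℝ (Fin d)) (α₀ S₀ : ℝ)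
    (θ₁ : EuclideanSpace ℝ (Fin d)) (x : ℕ → Ξ) (n : ℕ) : EuclideanSpace ℝ (Fin d) :=
  (adaGradState G α₀ S₀ θ₁ x (n - 1)).1

/-- The accumulator `S_n` of AdaGrad-Norm, for `n ≥ 0`. -/
def adaGradAcc {d : ℕ} {Ξ : Type*}
    (G : EuclideanSpace ℝ (Fin d) → Ξ → EuclideanSpace ℝ (Fin d)) (α₀ S₀ : ℝ)
    (θ₁ : EuclideanSpace ℝ (Fin d)) (x : ℕ → Ξ) (n : ℕ) : ℝ :=
  (adaGradState G α₀ S₀ θ₁ x n).2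

/-- The history `F_n = σ(ξ_1, …, ξ_n)`; it is trivial for `n = 0`. (The initial point is
deterministic, so it contributes nothing.) -/
@[reducible] def noiseHistory {Ω Ξ : Type*} [MeasurableSpace Ξ] (ξ : ℕ → Ω → Ξ) (n : ℕ) : MeasurableSpace Ω :=
  ⨆ k ∈ Set.Icc 1 n, MeasurableSpace.comap (ξ k) inferInstance

/-! The defining recursion of AdaGrad-Norm, in its usual form. -/

theorem adaGradIter_one {d : ℕ} {Ξ : Type*}
    (G : EuclideanSpace ℝ (Fin d) → Ξ → EuclideanSpace ℝ (Fin d)) (α₀ S₀ : ℝ)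
    (θ₁ : EuclideanSpace ℝ (Fin d)) (x : ℕ → Ξ) : adaGradIter G α₀ S₀ θ₁ x 1 = θ₁ := rfl

theorem adaGradAcc_zero {d : ℕ} {Ξ : Type*}
    (G : EuclideanSpace ℝ (Fin d) → Ξ → EuclideanSpace ℝ (Fin d)) (α₀ S₀ : ℝ)
    (θ₁ : EuclideanSpace ℝ (Fin d)) (x : ℕ → Ξ) : adaGradAcc G α₀ S₀ θ₁ x 0 = S₀ := rfl

theorem adaGradAcc_rec {d : ℕ} {Ξ : Type*}
    (G : EuclideanSpace ℝ (Fin d) → Ξ → EuclideanSpace ℝ (Fin d)) (α₀ S₀ : ℝ)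
    (θ₁ : EuclideanSpace ℝ (Fin d)) (x : ℕ → Ξ) (n : ℕ) (hn : 1 ≤ n) :
    adaGradAcc G α₀ S₀ θ₁ x n = adaGradAcc G α₀ S₀ θ₁ x (n - 1)
      + ‖G (adaGradIter G α₀ S₀ θ₁ x n) (x n)‖ ^ 2 := by
  obtain ⟨m, rfl⟩ : ∃ m, n = m + 1 := ⟨n - 1, by omega⟩
  rfl

theorem adaGradIter_rec {d : ℕ} {Ξ : Type*}
    (G : EuclideanSpace ℝ (Fin d) → Ξ → EuclideanSpace ℝ (Fin d)) (α₀ S₀ : ℝ)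
    (θ₁ : EuclideanSpace ℝ (Fin d)) (x : ℕ → Ξ) (n : ℕ) (hn : 1 ≤ n) :
    adaGradIter G α₀ S₀ θ₁ x (n + 1) = adaGradIter G α₀ S₀ θ₁ x n
      - (α₀ / √(adaGradAcc G α₀ S₀ θ₁ x n)) • G (adaGradIter G α₀ S₀ θ₁ x n) (x n) := by
  obtain ⟨m, rfl⟩ : ∃ m, n = m + 1 := ⟨n - 1, by omega⟩
  rfl

/-- The standing assumptions on the objective: `g` is continuously differentiable and
non-negative, and its gradient is `L`-Lipschitz. -/
structure IsSmoothObjective {d : ℕ} (g : EuclideanSpace ℝ (Fin d) → ℝ) (L : ℝ) : Prop where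
  contDiff : ContDiff ℝ 1 g
  nonneg : ∀ θ, 0 ≤ g θ
  lipschitz : ∀ θ θ', ‖gradient g θ - gradient g θ'‖ ≤ L * ‖θ - θ'‖

/-- The standing assumptions on the stochastic first-order oracle `G` with noise `ξ_1, ξ_2, …`
(`ξ 0` is never used), along the trajectory of AdaGrad-Norm: the oracle is
measurable, the noise variables are independent, the stochastic gradients are unbiased given the
past, and their conditional second moment is at most affine in the squared gradient norm.
Square-integrability says that the conditional expectations in the last two fields
are genuine ones. -/
structure IsAffineNoiseOracle {d : ℕ} {Ω Ξ : Type*} [MeasurableSpace Ω] [MeasurableSpace Ξ]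
    (μ : Measure Ω) (g : EuclideanSpace ℝ (Fin d) → ℝ)
    (G : EuclideanSpace ℝ (Fin d) → Ξ → EuclideanSpace ℝ (Fin d)) (ξ : ℕ → Ω → Ξ)
    (α₀ S₀ : ℝ) (θ₁ : EuclideanSpace ℝ (Fin d)) (σ₀ σ₁ : ℝ) : Prop where
  measurable_oracle : Measurable (Function.uncurry G)
  measurable_noise : ∀ n, 1 ≤ n → Measurable (ξ n)
  indep_noise : iIndepFun (fun n : ℕ => ξ (n + 1)) μ
  memLp : ∀ n, 1 ≤ n →
    MemLp (fun ω => G (adaGradIter G α₀ S₀ θ₁ (fun k => ξ k ω) n) (ξ n ω)) 2 μ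
  unbiased : ∀ n, 1 ≤ n →
    μ[fun ω => G (adaGradIter G α₀ S₀ θ₁ (fun k => ξ k ω) n) (ξ n ω) | noiseHistory ξ (n - 1)]
      =ᵐ[μ] fun ω => gradient g (adaGradIter G α₀ S₀ θ₁ (fun k => ξ k ω) n)
  affine_variance : ∀ n, 1 ≤ n →
    μ[fun ω => ‖G (adaGradIter G α₀ S₀ θ₁ (fun k => ξ k ω) n) (ξ n ω)‖ ^ 2
        | noiseHistory ξ (n - 1)]
      ≤ᵐ[μ] fun ω =>
        σ₀ * ‖gradient g (adaGradIter G α₀ S₀ θ₁ (fun k => ξ k ω) n)‖ ^ 2 + σ₁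

end

/-! The step size uses the updated accumulator, so it is correlated with the current noise.
Replacing it by the one built from the old accumulator costs, by Young's inequality and the affine
variance bound, half of the expected descent plus a multiple of (σ₀‖∇g‖² + σ₁) times the decrease of
1/√S. The Lyapunov function W = g + 4α₀(σ₀‖∇g‖² + σ₁)/√S pays for the latter (`potential_step`,
`drift_le`). With r the relative growth of S in one step, the conditional increment of W is at most
-(α₀/4)‖∇g‖²/√S plus a multiple of the conditional mean of r, and the sum of the r is at most
log(S_T/S₀).

Multiplying by the old √S and summing by parts leaves the sum of E[W_{n+1}(√S_{n+1} - √S_n)]. No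
supremum of W is taken: W is dominated by a submartingale Y, namely a constant plus a martingale
plus a multiple of the sum of the r. The weights are known at time n+1, so W_{n+1} may be replaced
by the terminal Y_T, and the sum collapses to E[Y_T(√S_T - √S₀)] (`sum_integral_mul_le`,
`sum_integral_V_sq_le`). Cauchy–Schwarz then needs E[Y_T²] and E[S_T].

The squared martingale increments are controlled by (W+1)r and WN, with N the decrement of W. The
recursion for E[W²] bounds the WN terms by the (W+1)r terms, the same passage to Y_T bounds those,
and absorption yields E[Y_T²] ≲ 1 + E[(∑ r)²] (`integral_majorant_sq_le`). Gradients grow at most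
linearly in n, so E[S_T] is polynomial in T and E[(∑ r)²] is O(log² T) (`integral_sum_ratio_sq_le`).
The sum X of the E‖∇g‖² thus satisfies X ≲ 1 + log T · √(T + X), whence X ≲ √T log T, and Markov's
inequality concludes. -/

open scoped RealInnerProductSpace

/-! ### Integrals and conditional expectations of square-integrable functions. -/

section CondExpSquareIntegrable

variable {Ω : Type*} {m m0 : MeasurableSpace Ω} {μ : Measure Ω} [IsProbabilityMeasure μ]

omit [IsProbabilityMeasure μ] in
theorem integral_linearCombination {f g h : Ω → ℝ} (hf : Integrable f μ) (hg : Integrable g μ)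
    (hh : Integrable h μ) (a b c : ℝ) :
    Integrable (fun ω => a * f ω + b * g ω + c * h ω) μ ∧
    ∫ ω, (a * f ω + b * g ω + c * h ω) ∂μ
      = a * ∫ ω, f ω ∂μ + b * ∫ ω, g ω ∂μ + c * ∫ ω, h ω ∂μ := by
  have i : Integrable (fun ω => a * f ω + b * g ω) μ := (hf.const_mul a).add (hg.const_mul b)
  refine ⟨i.add (hh.const_mul c), ?_⟩
  rw [integral_add i (hh.const_mul c), integral_add (hf.const_mul a) (hg.const_mul b),
    integral_const_mul, integral_const_mul, integral_const_mul]

omit [IsProbabilityMeasure μ] in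
theorem integral_le_linearCombination {u f g h : Ω → ℝ} (hu : Integrable u μ)
    (hf : Integrable f μ) (hg : Integrable g μ) (hh : Integrable h μ) (a b c : ℝ)
    (H : ∀ ω, u ω ≤ a * f ω + b * g ω + c * h ω) :
    ∫ ω, u ω ∂μ ≤ a * ∫ ω, f ω ∂μ + b * ∫ ω, g ω ∂μ + c * ∫ ω, h ω ∂μ := by
  obtain ⟨i, e⟩ := integral_linearCombination hf hg hh a b c
  rw [← e]
  exact integral_mono hu i H

omit [IsProbabilityMeasure μ] in
theorem integral_eq_linearCombination {u f g h : Ω → ℝ}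
    (hf : Integrable f μ) (hg : Integrable g μ) (hh : Integrable h μ) (a b c : ℝ)
    (H : ∀ ω, u ω = a * f ω + b * g ω + c * h ω) :
    ∫ ω, u ω ∂μ = a * ∫ ω, f ω ∂μ + b * ∫ ω, g ω ∂μ + c * ∫ ω, h ω ∂μ := by
  rw [← (integral_linearCombination hf hg hh a b c).2]
  exact integral_congr_ae (ae_of_all _ H)

theorem integral_mul_condExp_of_stronglyMeasurable (hm : m ≤ m0) {Z X : Ω → ℝ}
    (hZm : StronglyMeasurable[m] Z) (hZ : MemLp Z 2 μ) (hX : MemLp X 2 μ) :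
    ∫ ω, Z ω * (μ[X | m]) ω ∂μ = ∫ ω, Z ω * X ω ∂μ := by
  have h := condExp_mul_of_stronglyMeasurable_left (μ := μ) hZm (hZ.integrable_mul hX)
    (hX.integrable one_le_two)
  rw [← integral_condExp (μ := μ) (f := fun ω => Z ω * X ω) hm]
  exact (integral_congr_ae h).symm

theorem integral_mul_sub_condExp (hm : m ≤ m0) {Z X : Ω → ℝ}
    (hZm : StronglyMeasurable[m] Z) (hZ : MemLp Z 2 μ) (hX : MemLp X 2 μ) :
    ∫ ω, Z ω * (X ω - (μ[X | m]) ω) ∂μ = 0 := by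
  have h1 : Integrable (fun ω => Z ω * X ω) μ := hZ.integrable_mul hX
  have h2 : Integrable (fun ω => Z ω * (μ[X | m]) ω) μ :=
    hZ.integrable_mul (hX.condExp one_le_two)
  simp only [mul_sub]
  rw [integral_sub h1 h2, integral_mul_condExp_of_stronglyMeasurable hm hZm hZ hX, sub_self]

theorem integral_mul_nonpos_of_condExp_nonpos (hm : m ≤ m0) {Z X : Ω → ℝ}
    (hZm : StronglyMeasurable[m] Z) (hZ : MemLp Z 2 μ) (hX : MemLp X 2 μ)
    (hZ0 : ∀ ω, 0 ≤ Z ω) (h : μ[X | m] ≤ᵐ[μ] 0) :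
    ∫ ω, Z ω * X ω ∂μ ≤ 0 := by
  rw [← integral_mul_condExp_of_stronglyMeasurable hm hZm hZ hX]
  refine integral_nonpos_of_ae ?_
  filter_upwards [h] with ω hω
  exact mul_nonpos_of_nonneg_of_nonpos (hZ0 ω) hω

theorem integral_sq_sub_condExp_le (hm : m ≤ m0) {X : Ω → ℝ} (hX : MemLp X 2 μ) :
    ∫ ω, (X ω - (μ[X | m]) ω) ^ 2 ∂μ ≤ ∫ ω, X ω ^ 2 ∂μ := by
  have hc : MemLp (μ[X | m]) 2 μ := hX.condExp one_le_two
  have h0 := integral_mul_sub_condExp hm stronglyMeasurable_condExp hc hX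
  have h1 : Integrable (fun ω => X ω ^ 2) μ := hX.integrable_sq
  have h2 : Integrable (fun ω => (X ω - (μ[X | m]) ω) ^ 2) μ := (hX.sub hc).integrable_sq
  have h3 : Integrable (fun ω => (μ[X | m]) ω * (X ω - (μ[X | m]) ω)) μ :=
    hc.integrable_mul (hX.sub hc)
  have : ∫ ω, (X ω - (μ[X | m]) ω) ^ 2 ∂μ + 2 * ∫ ω, (μ[X | m]) ω * (X ω - (μ[X | m]) ω) ∂μ
      ≤ ∫ ω, X ω ^ 2 ∂μ := by
    rw [← integral_const_mul, ← integral_add h2 (h3.const_mul 2)]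
    refine integral_mono (h2.add (h3.const_mul 2)) h1 fun ω => ?_
    simp only
    nlinarith [sq_nonneg ((μ[X | m]) ω)]
  linarith

omit [IsProbabilityMeasure μ] in
theorem integral_mul_le_sqrt_mul_sqrt {X Y : Ω → ℝ} (hX : MemLp X 2 μ) (hY : MemLp Y 2 μ) :
    ∫ ω, X ω * Y ω ∂μ ≤ √(∫ ω, X ω ^ 2 ∂μ) * √(∫ ω, Y ω ^ 2 ∂μ) := by
  have hXY : Integrable (fun ω => X ω * Y ω) μ := hX.integrable_mul hY
  set A := ∫ ω, X ω ^ 2 ∂μ with hA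
  set B := ∫ ω, Y ω ^ 2 ∂μ with hB
  set I := ∫ ω, X ω * Y ω ∂μ with hI
  have hA0 : 0 ≤ A := integral_nonneg fun ω => sq_nonneg _
  have key : ∀ t : ℝ, 0 ≤ B * (t * t) + (-(2 * I)) * t + A := by
    intro t
    have : ∫ ω, (X ω - t * Y ω) ^ 2 ∂μ = B * (t * t) + (-(2 * I)) * t + A := by
      rw [integral_eq_linearCombination hX.integrable_sq hXY hY.integrable_sq
        1 (-(2 * t)) (t * t) fun ω => by ring]
      ring
    rw [← this]
    exact integral_nonneg fun ω => sq_nonneg _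
  have hd := discrim_le_zero key
  rw [discrim] at hd
  rw [← Real.sqrt_mul hA0]
  exact Real.le_sqrt_of_sq_le (by nlinarith)

end CondExpSquareIntegrable

/-! ### Second moments for processes with controlled drift. -/

/-- A nonnegative adapted process `W` whose increments are at most `R - N`, where `N` is a decrement
that dominates the conditional drift of `R` up to a multiple of `r`, and where `R` is controlled
quadratically by `(W + 1) * r`. -/
structure DriftControlled {Ω : Type*} {m0 : MeasurableSpace Ω} (μ : Measure Ω)
    (ℱ : Filtration ℕ m0) (C₁ C₂ C₃ w₀ : ℝ) (W N R r : ℕ → Ω → ℝ) : Prop where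
  meas_W : ∀ n, StronglyMeasurable[ℱ n] (W n)
  meas_N : ∀ n, StronglyMeasurable[ℱ (n + 1)] (N n)
  meas_R : ∀ n, StronglyMeasurable[ℱ (n + 1)] (R n)
  meas_r : ∀ n, StronglyMeasurable[ℱ (n + 1)] (r n)
  bdd_W : ∀ n, ∃ B, ∀ ω, W n ω ≤ B
  W_zero_le : ∀ ω, W 0 ω ≤ w₀
  W_nonneg : ∀ n ω, 0 ≤ W n ω
  N_nonneg : ∀ n ω, 0 ≤ N n ω
  N_le : ∀ n ω, N n ω ≤ W n ω
  r_nonneg : ∀ n ω, 0 ≤ r n ω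
  r_le_one : ∀ n ω, r n ω ≤ 1
  step : ∀ n ω, W (n + 1) ω ≤ W n ω + R n ω - N n ω
  R_sq_le : ∀ n ω, R n ω ^ 2 ≤ C₃ * ((W n ω + 1) * r n ω)
  back : ∀ n ω, W n ω ≤ C₂ * (W (n + 1) ω + 1)
  drift : ∀ n, μ[fun ω => R n ω - N n ω / 8 - C₁ * r n ω | ℱ n] ≤ᵐ[μ] 0

namespace DriftControlled

variable {Ω : Type*} {m0 : MeasurableSpace Ω} {μ : Measure Ω} [IsProbabilityMeasure μ]
  {ℱ : Filtration ℕ m0} {C₁ C₂ C₃ w₀ : ℝ} {W N R r : ℕ → Ω → ℝ}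

theorem memLp_W (h : DriftControlled μ ℱ C₁ C₂ C₃ w₀ W N R r) (n : ℕ) : MemLp (W n) 2 μ := by
  obtain ⟨B, hB⟩ := h.bdd_W n
  exact MemLp.of_bound ((h.meas_W n).mono (ℱ.le n)).aestronglyMeasurable B
    (ae_of_all _ fun ω => by rw [Real.norm_of_nonneg (h.W_nonneg n ω)]; exact hB ω)

theorem memLp_N (h : DriftControlled μ ℱ C₁ C₂ C₃ w₀ W N R r) (n : ℕ) : MemLp (N n) 2 μ := by
  obtain ⟨B, hB⟩ := h.bdd_W n
  exact MemLp.of_bound ((h.meas_N n).mono (ℱ.le _)).aestronglyMeasurable B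
    (ae_of_all _ fun ω => by
      rw [Real.norm_of_nonneg (h.N_nonneg n ω)]; exact (h.N_le n ω).trans (hB ω))

theorem memLp_r (h : DriftControlled μ ℱ C₁ C₂ C₃ w₀ W N R r) (n : ℕ) : MemLp (r n) 2 μ :=
  MemLp.of_bound ((h.meas_r n).mono (ℱ.le _)).aestronglyMeasurable 1
    (ae_of_all _ fun ω => by rw [Real.norm_of_nonneg (h.r_nonneg n ω)]; exact h.r_le_one n ω)

theorem memLp_R (h : DriftControlled μ ℱ C₁ C₂ C₃ w₀ W N R r) (hC₃ : 0 ≤ C₃) (n : ℕ) :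
    MemLp (R n) 2 μ := by
  obtain ⟨B, hB⟩ := h.bdd_W n
  refine MemLp.of_bound ((h.meas_R n).mono (ℱ.le _)).aestronglyMeasurable (√(C₃ * (B + 1)))
    (ae_of_all _ fun ω => Real.abs_le_sqrt ((h.R_sq_le n ω).trans ?_))
  refine mul_le_mul_of_nonneg_left ?_ hC₃
  nlinarith [h.r_le_one n ω, h.r_nonneg n ω, h.W_nonneg n ω, hB ω]

/-- The part of the increment of `W` with nonpositive conditional mean. -/
def excess (C₁ : ℝ) (N R r : ℕ → Ω → ℝ) (n : ℕ) (ω : Ω) : ℝ := R n ω - N n ω - C₁ * r n ω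

/-- The submartingale that dominates `W`. -/
noncomputable def majorant (μ : Measure Ω) (ℱ : Filtration ℕ m0) (C₁ w₀ : ℝ) (N R r : ℕ → Ω → ℝ) :
    ℕ → Ω → ℝ
  | 0 => fun _ => w₀
  | n + 1 => fun ω => majorant μ ℱ C₁ w₀ N R r n ω
      + (excess C₁ N R r n ω - (μ[excess C₁ N R r n | ℱ n]) ω) + C₁ * r n ω

/-- The martingale part of `majorant`. -/
noncomputable def martPart (μ : Measure Ω) (ℱ : Filtration ℕ m0) (C₁ : ℝ) (N R r : ℕ → Ω → ℝ) :
    ℕ → Ω → ℝ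
  | 0 => fun _ => 0
  | n + 1 => fun ω => martPart μ ℱ C₁ N R r n ω
      + (excess C₁ N R r n ω - (μ[excess C₁ N R r n | ℱ n]) ω)

omit [IsProbabilityMeasure μ] in
theorem majorant_eq (n : ℕ) (ω : Ω) : majorant μ ℱ C₁ w₀ N R r n ω
    = w₀ + martPart μ ℱ C₁ N R r n ω + C₁ * ∑ k ∈ Finset.range n, r k ω := by
  induction n with
  | zero => simp [majorant, martPart]
  | succ n ih => simp only [majorant, martPart, ih, Finset.sum_range_succ]; ring

theorem memLp_excess (h : DriftControlled μ ℱ C₁ C₂ C₃ w₀ W N R r) (hC₃ : 0 ≤ C₃) (n : ℕ) :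
    MemLp (excess C₁ N R r n) 2 μ :=
  ((h.memLp_R hC₃ n).sub (h.memLp_N n)).sub ((h.memLp_r n).const_mul C₁)

omit [IsProbabilityMeasure μ] in
theorem meas_excess (h : DriftControlled μ ℱ C₁ C₂ C₃ w₀ W N R r) (n : ℕ) :
    StronglyMeasurable[ℱ (n + 1)] (excess C₁ N R r n) :=
  ((h.meas_R n).sub (h.meas_N n)).sub ((h.meas_r n).const_mul C₁)

theorem memLp_martPart (h : DriftControlled μ ℱ C₁ C₂ C₃ w₀ W N R r) (hC₃ : 0 ≤ C₃) (n : ℕ) :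
    MemLp (martPart μ ℱ C₁ N R r n) 2 μ := by
  induction n with
  | zero => exact memLp_const 0
  | succ n ih =>
    exact ih.add ((h.memLp_excess hC₃ n).sub ((h.memLp_excess hC₃ n).condExp one_le_two))

omit [IsProbabilityMeasure μ] in
theorem meas_martPart (h : DriftControlled μ ℱ C₁ C₂ C₃ w₀ W N R r) (n : ℕ) :
    StronglyMeasurable[ℱ n] (martPart μ ℱ C₁ N R r n) := by
  induction n with
  | zero => exact stronglyMeasurable_const
  | succ n ih =>
    exact (ih.mono (ℱ.mono n.le_succ)).add ((h.meas_excess n).sub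
      (stronglyMeasurable_condExp.mono (ℱ.mono n.le_succ)))

theorem memLp_sum_r (h : DriftControlled μ ℱ C₁ C₂ C₃ w₀ W N R r) (n : ℕ) :
    MemLp (fun ω => ∑ k ∈ Finset.range n, r k ω) 2 μ :=
  memLp_finsetSum _ fun k _ => h.memLp_r k

theorem memLp_majorant (h : DriftControlled μ ℱ C₁ C₂ C₃ w₀ W N R r) (hC₃ : 0 ≤ C₃) (n : ℕ) :
    MemLp (majorant μ ℱ C₁ w₀ N R r n) 2 μ := by
  have : majorant μ ℱ C₁ w₀ N R r n
      = fun ω => w₀ + martPart μ ℱ C₁ N R r n ω + C₁ * ∑ k ∈ Finset.range n, r k ω :=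
    funext (majorant_eq n)
  rw [this]
  exact ((memLp_const w₀).add (h.memLp_martPart hC₃ n)).add ((h.memLp_sum_r n).const_mul C₁)

theorem condExp_excess_nonpos (h : DriftControlled μ ℱ C₁ C₂ C₃ w₀ W N R r) (hC₃ : 0 ≤ C₃)
    (n : ℕ) : μ[excess C₁ N R r n | ℱ n] ≤ᵐ[μ] 0 := by
  refine (condExp_mono ((h.memLp_excess hC₃ n).integrable one_le_two) ?_
    (ae_of_all _ fun ω => ?_)).trans (h.drift n)
  · exact (((h.memLp_R hC₃ n).sub ((h.memLp_N n).mul_const (8⁻¹ : ℝ))).sub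
      ((h.memLp_r n).const_mul C₁)).integrable one_le_two
  · have := h.N_nonneg n ω
    simp only [excess]
    linarith

/-- The compensator of `excess` is nonpositive, so subtracting it can only raise the process. -/
theorem le_majorant (h : DriftControlled μ ℱ C₁ C₂ C₃ w₀ W N R r) (hC₃ : 0 ≤ C₃) (n : ℕ) :
    W n ≤ᵐ[μ] majorant μ ℱ C₁ w₀ N R r n := by
  induction n with
  | zero => exact ae_of_all _ h.W_zero_le
  | succ n ih =>
    filter_upwards [ih, h.condExp_excess_nonpos hC₃ n] with ω h1 h2
    have h3 := h.step n ω
    simp only [majorant, excess, Pi.zero_apply] at h2 ⊢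
    change _ ≤ _ + (_ - (μ[excess C₁ N R r n | ℱ n]) ω) + _
    change (μ[excess C₁ N R r n | ℱ n]) ω ≤ 0 at h2
    linarith

/-- The submartingale property tested against `Z`: each later increment is a centred term,
orthogonal to `Z`, plus the nonnegative `C₁ * r`. -/
theorem integral_majorant_mul_mono (h : DriftControlled μ ℱ C₁ C₂ C₃ w₀ W N R r)
    (hC₁ : 0 ≤ C₁) (hC₃ : 0 ≤ C₃) {n k : ℕ} (hnk : n ≤ k) {Z : Ω → ℝ}
    (hZm : StronglyMeasurable[ℱ n] Z) (hZ : MemLp Z 2 μ) (hZ0 : ∀ ω, 0 ≤ Z ω) :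
    ∫ ω, majorant μ ℱ C₁ w₀ N R r n ω * Z ω ∂μ
      ≤ ∫ ω, majorant μ ℱ C₁ w₀ N R r k ω * Z ω ∂μ := by
  induction k, hnk using Nat.le_induction with
  | base => exact le_rfl
  | succ k hk ih =>
    refine ih.trans ?_
    have hD : MemLp (fun ω => excess C₁ N R r k ω - (μ[excess C₁ N R r k | ℱ k]) ω) 2 μ :=
      (h.memLp_excess hC₃ k).sub ((h.memLp_excess hC₃ k).condExp one_le_two)
    have h0 := integral_mul_sub_condExp (ℱ.le k) (hZm.mono (ℱ.mono hk)) hZ (h.memLp_excess hC₃ k)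
    have i1 : Integrable (fun ω => majorant μ ℱ C₁ w₀ N R r k ω * Z ω) μ :=
      (h.memLp_majorant hC₃ k).integrable_mul hZ
    have i2 : Integrable (fun ω => Z ω *
      (excess C₁ N R r k ω - (μ[excess C₁ N R r k | ℱ k]) ω)) μ := hZ.integrable_mul hD
    have i3 := (h.memLp_majorant hC₃ (k + 1)).integrable_mul hZ
    have : ∫ ω, majorant μ ℱ C₁ w₀ N R r k ω * Z ω ∂μ
        + ∫ ω, Z ω * (excess C₁ N R r k ω - (μ[excess C₁ N R r k | ℱ k]) ω) ∂μ
        ≤ ∫ ω, majorant μ ℱ C₁ w₀ N R r (k + 1) ω * Z ω ∂μ := by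
      rw [← integral_add i1 i2]
      refine integral_mono (i1.add i2) i3 fun ω => ?_
      have := mul_nonneg (mul_nonneg hC₁ (h.r_nonneg k ω)) (hZ0 ω)
      simp only [majorant]
      linarith
    linarith

/-- Summation against nonnegative weights: `W` may be replaced by the terminal majorant. -/
theorem sum_integral_mul_le (h : DriftControlled μ ℱ C₁ C₂ C₃ w₀ W N R r)
    (hC₁ : 0 ≤ C₁) (hC₃ : 0 ≤ C₃) {Z : ℕ → Ω → ℝ}
    (hZm : ∀ n, StronglyMeasurable[ℱ (n + 1)] (Z n)) (hZ : ∀ n, MemLp (Z n) 2 μ)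
    (hZ0 : ∀ n ω, 0 ≤ Z n ω) (T : ℕ) :
    ∑ n ∈ Finset.range T, ∫ ω, W (n + 1) ω * Z n ω ∂μ
      ≤ ∫ ω, majorant μ ℱ C₁ w₀ N R r T ω * ∑ n ∈ Finset.range T, Z n ω ∂μ := by
  simp only [Finset.mul_sum]
  have i0 : ∀ n, Integrable (fun ω => majorant μ ℱ C₁ w₀ N R r T ω * Z n ω) μ :=
    fun n => (h.memLp_majorant hC₃ T).integrable_mul (hZ n)
  rw [integral_finsetSum _ fun n _ => i0 n]
  refine Finset.sum_le_sum fun n hn => ?_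
  refine le_trans ?_ (h.integral_majorant_mul_mono hC₁ hC₃
    (Nat.succ_le_of_lt (Finset.mem_range.mp hn)) (hZm n) (hZ n) (hZ0 n))
  refine integral_mono_ae ((h.memLp_W (n + 1)).integrable_mul (hZ n))
    ((h.memLp_majorant hC₃ (n + 1)).integrable_mul (hZ n)) ?_
  filter_upwards [h.le_majorant hC₃ (n + 1)] with ω hω
  exact mul_le_mul_of_nonneg_right hω (hZ0 n ω)

/-- Martingale increments are orthogonal, and centring does not increase a second moment. -/
theorem integral_martPart_sq_le (h : DriftControlled μ ℱ C₁ C₂ C₃ w₀ W N R r) (hC₃ : 0 ≤ C₃)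
    (T : ℕ) : ∫ ω, martPart μ ℱ C₁ N R r T ω ^ 2 ∂μ
      ≤ ∑ n ∈ Finset.range T, ∫ ω, excess C₁ N R r n ω ^ 2 ∂μ := by
  induction T with
  | zero => simp [martPart]
  | succ n ih =>
    rw [Finset.sum_range_succ]
    have hM := h.memLp_martPart hC₃ n
    have hD : MemLp (fun ω => excess C₁ N R r n ω - (μ[excess C₁ N R r n | ℱ n]) ω) 2 μ :=
      (h.memLp_excess hC₃ n).sub ((h.memLp_excess hC₃ n).condExp one_le_two)
    have h0 := integral_mul_sub_condExp (ℱ.le n) (h.meas_martPart n) hM (h.memLp_excess hC₃ n)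
    have h1 := integral_sq_sub_condExp_le (ℱ.le n) (h.memLp_excess hC₃ n)
    have i2 : Integrable (fun ω => martPart μ ℱ C₁ N R r n ω *
      (excess C₁ N R r n ω - (μ[excess C₁ N R r n | ℱ n]) ω)) μ := hM.integrable_mul hD
    have e : ∫ ω, martPart μ ℱ C₁ N R r (n + 1) ω ^ 2 ∂μ
        = ∫ ω, martPart μ ℱ C₁ N R r n ω ^ 2 ∂μ
        + 2 * ∫ ω, martPart μ ℱ C₁ N R r n ω *
          (excess C₁ N R r n ω - (μ[excess C₁ N R r n | ℱ n]) ω) ∂μ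
        + ∫ ω, (excess C₁ N R r n ω - (μ[excess C₁ N R r n | ℱ n]) ω) ^ 2 ∂μ := by
      rw [integral_eq_linearCombination hM.integrable_sq i2 hD.integrable_sq 1 2 1
        fun ω => by simp only [martPart]; ring]
      ring
    linarith

/-- The drift bound spends only an eighth of `N`. In the square, the remaining part gives `-(7/4) W
N`, which beats the `(3/2) N ^ 2` produced by `(R - N) ^ 2` because `N ≤ W`; a quarter of `W N` is
left over. -/
theorem integral_W_sq_step (h : DriftControlled μ ℱ C₁ C₂ C₃ w₀ W N R r) (hC₁ : 0 ≤ C₁)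
    (hC₃ : 0 ≤ C₃) (n : ℕ) :
    ∫ ω, W (n + 1) ω ^ 2 ∂μ + 1 / 4 * ∫ ω, W n ω * N n ω ∂μ
      ≤ ∫ ω, W n ω ^ 2 ∂μ + (2 * C₁ + 3 * C₃) * ∫ ω, (W n ω + 1) * r n ω ∂μ := by
  have hW := h.memLp_W n
  have hX : MemLp (fun ω => R n ω - N n ω / 8 - C₁ * r n ω) 2 μ :=
    ((h.memLp_R hC₃ n).sub ((h.memLp_N n).mul_const (8⁻¹ : ℝ))).sub ((h.memLp_r n).const_mul C₁)
  have h0 := integral_mul_nonpos_of_condExp_nonpos (ℱ.le n) (h.meas_W n) hW hX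
    (h.W_nonneg n) (h.drift n)
  have i0 : Integrable (fun ω => W n ω * (R n ω - N n ω / 8 - C₁ * r n ω)) μ :=
    hW.integrable_mul hX
  have i1 : Integrable (fun ω => W n ω * N n ω) μ := hW.integrable_mul (h.memLp_N n)
  have i2 : Integrable (fun ω => (W n ω + 1) * r n ω) μ :=
    (hW.add (memLp_const 1)).integrable_mul (h.memLp_r n)
  have : ∫ ω, W (n + 1) ω ^ 2 ∂μ + 1 / 4 * ∫ ω, W n ω * N n ω ∂μ
      ≤ ∫ ω, W n ω ^ 2 ∂μ + (2 * C₁ + 3 * C₃) * ∫ ω, (W n ω + 1) * r n ω ∂μ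
        + 2 * ∫ ω, W n ω * (R n ω - N n ω / 8 - C₁ * r n ω) ∂μ := by
    rw [← integral_const_mul (1 / 4), ← integral_add (h.memLp_W (n + 1)).integrable_sq
      (i1.const_mul _), ← one_mul (∫ ω, W n ω ^ 2 ∂μ)]
    refine integral_le_linearCombination ((h.memLp_W (n + 1)).integrable_sq.add (i1.const_mul _))
      hW.integrable_sq i2 i0 _ _ _ fun ω => ?_
    change W (n + 1) ω ^ 2 + 1 / 4 * (W n ω * N n ω) ≤ _
    have a1 := h.step n ω
    have a2 := h.W_nonneg (n + 1) ω
    have a3 := h.R_sq_le n ω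
    have a4 := h.N_nonneg n ω
    have a5 := h.N_le n ω
    have a6 := mul_nonneg hC₁ (h.r_nonneg n ω)
    have b1 : W (n + 1) ω ^ 2 ≤ (W n ω + R n ω - N n ω) ^ 2 := pow_le_pow_left₀ a2 a1 2
    have b2 : N n ω ^ 2 ≤ W n ω * N n ω := by nlinarith
    -- This square gives `(R - N) ^ 2 ≤ 3 R ^ 2 + (3/2) N ^ 2`.
    nlinarith [sq_nonneg (2 * R n ω + N n ω)]
  linarith

theorem sum_integral_W_mul_N_le (h : DriftControlled μ ℱ C₁ C₂ C₃ w₀ W N R r) (hC₁ : 0 ≤ C₁)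
    (hC₃ : 0 ≤ C₃) (T : ℕ) :
    ∑ n ∈ Finset.range T, ∫ ω, W n ω * N n ω ∂μ
      ≤ 4 * w₀ ^ 2 + 4 * (2 * C₁ + 3 * C₃)
        * ∑ n ∈ Finset.range T, ∫ ω, (W n ω + 1) * r n ω ∂μ := by
  have key : ∫ ω, W T ω ^ 2 ∂μ + 1 / 4 * ∑ n ∈ Finset.range T, ∫ ω, W n ω * N n ω ∂μ
      ≤ w₀ ^ 2 + (2 * C₁ + 3 * C₃) * ∑ n ∈ Finset.range T, ∫ ω, (W n ω + 1) * r n ω ∂μ := by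
    induction T with
    | zero =>
      have := integral_mono (h.memLp_W 0).integrable_sq (integrable_const (w₀ ^ 2))
        fun ω => pow_le_pow_left₀ (h.W_nonneg 0 ω) (h.W_zero_le ω) 2
      simpa using this
    | succ n ih =>
      rw [Finset.sum_range_succ, Finset.sum_range_succ]
      have := h.integral_W_sq_step hC₁ hC₃ n
      linarith
  have : 0 ≤ ∫ ω, W T ω ^ 2 ∂μ := integral_nonneg fun ω => sq_nonneg _
  linarith

theorem sum_integral_excess_sq_le (h : DriftControlled μ ℱ C₁ C₂ C₃ w₀ W N R r) (hC₁ : 0 ≤ C₁)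
    (hC₃ : 0 ≤ C₃) (T : ℕ) :
    ∑ n ∈ Finset.range T, ∫ ω, excess C₁ N R r n ω ^ 2 ∂μ
      ≤ 12 * w₀ ^ 2 + (3 * C₃ + 3 * C₁ ^ 2 + 12 * (2 * C₁ + 3 * C₃))
        * ∑ n ∈ Finset.range T, ∫ ω, (W n ω + 1) * r n ω ∂μ := by
  have key : ∀ n, ∫ ω, excess C₁ N R r n ω ^ 2 ∂μ
      ≤ (3 * C₃ + 3 * C₁ ^ 2) * ∫ ω, (W n ω + 1) * r n ω ∂μ + 3 * ∫ ω, W n ω * N n ω ∂μ := by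
    intro n
    have hW := h.memLp_W n
    have i1 : Integrable (fun ω => W n ω * N n ω) μ := hW.integrable_mul (h.memLp_N n)
    have i2 : Integrable (fun ω => (W n ω + 1) * r n ω) μ :=
      (hW.add (memLp_const 1)).integrable_mul (h.memLp_r n)
    rw [← integral_const_mul, ← integral_const_mul,
      ← integral_add (i2.const_mul _) (i1.const_mul _)]
    refine integral_mono (h.memLp_excess hC₃ n).integrable_sq
      ((i2.const_mul _).add (i1.const_mul _)) fun ω => ?_
    have a3 := h.R_sq_le n ω
    have a4 := h.N_nonneg n ω
    have a5 := h.N_le n ω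
    have a6 := h.r_nonneg n ω
    have a7 := h.r_le_one n ω
    have a8 := h.W_nonneg n ω
    have b2 : N n ω ^ 2 ≤ W n ω * N n ω := by nlinarith
    have b3 : r n ω ^ 2 ≤ (W n ω + 1) * r n ω := by nlinarith [mul_nonneg a8 a6]
    have b4 := mul_le_mul_of_nonneg_left b3 (sq_nonneg C₁)
    have b5 : (R n ω - N n ω - C₁ * r n ω) ^ 2
        ≤ 3 * (R n ω ^ 2 + N n ω ^ 2 + C₁ ^ 2 * r n ω ^ 2) := by
      nlinarith [sq_nonneg (R n ω + N n ω), sq_nonneg (R n ω + C₁ * r n ω),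
        sq_nonneg (N n ω - C₁ * r n ω)]
    simp only [excess]
    linarith
  have h1 := h.sum_integral_W_mul_N_le hC₁ hC₃ T
  calc _ ≤ ∑ n ∈ Finset.range T, ((3 * C₃ + 3 * C₁ ^ 2) * ∫ ω, (W n ω + 1) * r n ω ∂μ
        + 3 * ∫ ω, W n ω * N n ω ∂μ) := Finset.sum_le_sum fun n _ => key n
    _ = (3 * C₃ + 3 * C₁ ^ 2) * ∑ n ∈ Finset.range T, ∫ ω, (W n ω + 1) * r n ω ∂μ
        + 3 * ∑ n ∈ Finset.range T, ∫ ω, W n ω * N n ω ∂μ := by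
      rw [Finset.sum_add_distrib, Finset.mul_sum, Finset.mul_sum]
    _ ≤ _ := by linarith

/-- The weight `r n` is only known at time `n + 1`, so the passage to the terminal majorant applies
to `W (n + 1)`, not `W n`; `back` bridges the gap. -/
theorem sum_integral_W_mul_r_le (h : DriftControlled μ ℱ C₁ C₂ C₃ w₀ W N R r) (hC₁ : 0 ≤ C₁)
    (hC₂ : 0 ≤ C₂) (hC₃ : 0 ≤ C₃) (T : ℕ) :
    ∑ n ∈ Finset.range T, ∫ ω, (W n ω + 1) * r n ω ∂μ
      ≤ C₂ * ∫ ω, majorant μ ℱ C₁ w₀ N R r T ω * ∑ n ∈ Finset.range T, r n ω ∂μ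
        + (C₂ + 1) * ∫ ω, ∑ n ∈ Finset.range T, r n ω ∂μ := by
  have h1 := h.sum_integral_mul_le hC₁ hC₃ h.meas_r h.memLp_r h.r_nonneg T
  have key : ∀ n, ∫ ω, (W n ω + 1) * r n ω ∂μ
      ≤ C₂ * ∫ ω, W (n + 1) ω * r n ω ∂μ + (C₂ + 1) * ∫ ω, r n ω ∂μ := by
    intro n
    have i1 : Integrable (fun ω => W (n + 1) ω * r n ω) μ :=
      (h.memLp_W (n + 1)).integrable_mul (h.memLp_r n)
    have i2 : Integrable (fun ω => (W n ω + 1) * r n ω) μ :=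
      ((h.memLp_W n).add (memLp_const 1)).integrable_mul (h.memLp_r n)
    have i3 : Integrable (r n) μ := (h.memLp_r n).integrable one_le_two
    rw [← integral_const_mul, ← integral_const_mul,
      ← integral_add (i1.const_mul _) (i3.const_mul _)]
    refine integral_mono i2 ((i1.const_mul _).add (i3.const_mul _)) fun ω => ?_
    simp only
    nlinarith [h.back n ω, h.r_nonneg n ω]
  rw [integral_finsetSum _ fun n _ => (h.memLp_r n).integrable one_le_two]
  calc _ ≤ ∑ n ∈ Finset.range T, (C₂ * ∫ ω, W (n + 1) ω * r n ω ∂μ + (C₂ + 1) * ∫ ω, r n ω ∂μ) :=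
        Finset.sum_le_sum fun n _ => key n
    _ = C₂ * ∑ n ∈ Finset.range T, ∫ ω, W (n + 1) ω * r n ω ∂μ
        + (C₂ + 1) * ∑ n ∈ Finset.range T, ∫ ω, r n ω ∂μ := by
      rw [Finset.sum_add_distrib, Finset.mul_sum, Finset.mul_sum]
    _ ≤ _ := by gcongr

/-- The second moment of the majorant is controlled by that of the accumulated `r`. -/
theorem integral_majorant_sq_le (C₁ C₂ C₃ w₀ : ℝ) (hC₁ : 0 ≤ C₁)
    (hC₂ : 0 ≤ C₂) (hC₃ : 0 ≤ C₃) :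
    ∃ K : ℝ, 0 ≤ K ∧ ∀ {Ω : Type*} {m0 : MeasurableSpace Ω} {μ : Measure Ω}
      [IsProbabilityMeasure μ] {ℱ : Filtration ℕ m0} {W N R r : ℕ → Ω → ℝ},
      DriftControlled μ ℱ C₁ C₂ C₃ w₀ W N R r → ∀ T : ℕ,
      ∫ ω, majorant μ ℱ C₁ w₀ N R r T ω ^ 2 ∂μ
        ≤ K * (1 + ∫ ω, (∑ n ∈ Finset.range T, r n ω) ^ 2 ∂μ) := by
  set K₂ := 3 * C₃ + 3 * C₁ ^ 2 + 12 * (2 * C₁ + 3 * C₃) with hK₂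
  have hK₂0 : 0 ≤ K₂ := by positivity
  -- The outer factor 2 comes from absorbing half of the second moment of the majorant; 39 is 3 + 3
  -- · 12.
  refine ⟨2 * (39 * w₀ ^ 2 + (3 * K₂ * C₂) ^ 2 + 3 * K₂ * (C₂ + 1) + 3 * C₁ ^ 2),
    by positivity, ?_⟩
  intro Ω m0 μ _ ℱ W N R r h T
  have hY := h.memLp_majorant hC₃ T
  have hM := h.memLp_martPart hC₃ T
  have hρ := h.memLp_sum_r T
  have e1 := h.integral_martPart_sq_le hC₃ T
  have e2 := h.sum_integral_excess_sq_le hC₁ hC₃ T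
  have e3 := h.sum_integral_W_mul_r_le hC₁ hC₂ hC₃ T
  rw [← hK₂] at e2
  have e4 : ∫ ω, majorant μ ℱ C₁ w₀ N R r T ω ^ 2 ∂μ
      ≤ 3 * w₀ ^ 2 + 3 * ∫ ω, martPart μ ℱ C₁ N R r T ω ^ 2 ∂μ
        + 3 * C₁ ^ 2 * ∫ ω, (∑ n ∈ Finset.range T, r n ω) ^ 2 ∂μ := by
    have e : ∫ _ω : Ω, (1 : ℝ) ∂μ = 1 := by simp
    rw [← mul_one (3 * w₀ ^ 2), ← e]
    refine integral_le_linearCombination hY.integrable_sq (integrable_const _) hM.integrable_sq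
      hρ.integrable_sq _ _ _ fun ω => ?_
    simp only [majorant_eq]
    set x := martPart μ ℱ C₁ N R r T ω
    set y := ∑ n ∈ Finset.range T, r n ω
    nlinarith [sq_nonneg (w₀ - x), sq_nonneg (w₀ - C₁ * y), sq_nonneg (x - C₁ * y)]
  -- Young's inequality with weight 1/2 on the majorant: that term reappears on the left and is
  -- finite, so it can be absorbed.
  have e5 : 3 * K₂ * C₂ * ∫ ω, majorant μ ℱ C₁ w₀ N R r T ω * ∑ n ∈ Finset.range T, r n ω ∂μ
      ≤ 1 / 2 * ∫ ω, majorant μ ℱ C₁ w₀ N R r T ω ^ 2 ∂μ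
        + 1 / 2 * (3 * K₂ * C₂) ^ 2 * ∫ ω, (∑ n ∈ Finset.range T, r n ω) ^ 2 ∂μ := by
    have i1 : Integrable
        (fun ω => majorant μ ℱ C₁ w₀ N R r T ω * ∑ n ∈ Finset.range T, r n ω) μ :=
      hY.integrable_mul hρ
    rw [← integral_const_mul, ← integral_const_mul, ← integral_const_mul,
      ← integral_add (hY.integrable_sq.const_mul _) (hρ.integrable_sq.const_mul _)]
    refine integral_mono (i1.const_mul _) ((hY.integrable_sq.const_mul _).add
      (hρ.integrable_sq.const_mul _)) fun ω => ?_
    simp only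
    nlinarith [sq_nonneg (majorant μ ℱ C₁ w₀ N R r T ω
      - 3 * K₂ * C₂ * ∑ n ∈ Finset.range T, r n ω)]
  have e6 : ∫ ω, ∑ n ∈ Finset.range T, r n ω ∂μ
      ≤ 1 + ∫ ω, (∑ n ∈ Finset.range T, r n ω) ^ 2 ∂μ := by
    have : ∫ _ω : Ω, (1 : ℝ) ∂μ = 1 := by simp
    rw [← this, ← integral_add (integrable_const _) hρ.integrable_sq]
    refine integral_mono (hρ.integrable one_le_two)
      ((integrable_const _).add hρ.integrable_sq) fun ω => ?_
    simp only
    nlinarith [sq_nonneg (∑ n ∈ Finset.range T, r n ω - 1)]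
  have e7 : 0 ≤ ∫ ω, (∑ n ∈ Finset.range T, r n ω) ^ 2 ∂μ :=
    integral_nonneg fun ω => sq_nonneg _
  have e8 := mul_le_mul_of_nonneg_left e3 (by positivity : 0 ≤ 3 * K₂)
  have e9 := mul_le_mul_of_nonneg_left e6 (by positivity : 0 ≤ 3 * K₂ * (C₂ + 1))
  nlinarith [mul_nonneg (sq_nonneg w₀) e7, sq_nonneg (3 * K₂ * C₂), sq_nonneg C₁]

end DriftControlled

/-! ### Pathwise estimates for AdaGrad-Norm in scalar form. -/

/-- The scalar quantities that drive AdaGrad-Norm: `f n` is the objective, `V n` the gradient norm,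
`γ n` the norm of the stochastic gradient, `c n` its inner product with the gradient, and `s n` the
accumulator before step `n`. -/
structure AdaGradRun {Ω : Type*} {m0 : MeasurableSpace Ω} (μ : Measure Ω)
    (ℱ : Filtration ℕ m0) (L a σ₀ σ₁ S₀ g₁ : ℝ) (f V γ c s : ℕ → Ω → ℝ) : Prop where
  L_pos : 0 < L
  a_pos : 0 < a
  σ₀_pos : 0 < σ₀
  σ₁_pos : 0 < σ₁
  S₀_pos : 0 < S₀
  meas_f : ∀ n, StronglyMeasurable[ℱ n] (f n)
  meas_V : ∀ n, StronglyMeasurable[ℱ n] (V n)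
  meas_s : ∀ n, StronglyMeasurable[ℱ n] (s n)
  meas_γ : ∀ n, StronglyMeasurable[ℱ (n + 1)] (γ n)
  meas_c : ∀ n, StronglyMeasurable[ℱ (n + 1)] (c n)
  f_zero : ∀ ω, f 0 ω = g₁
  f_nonneg : ∀ n ω, 0 ≤ f n ω
  V_nonneg : ∀ n ω, 0 ≤ V n ω
  γ_nonneg : ∀ n ω, 0 ≤ γ n ω
  V_sq_le : ∀ n ω, V n ω ^ 2 ≤ 2 * L * f n ω
  abs_c_le : ∀ n ω, |c n ω| ≤ V n ω * γ n ω
  s_zero : ∀ ω, s 0 ω = S₀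
  s_succ : ∀ n ω, s (n + 1) ω = s n ω + γ n ω ^ 2
  descent : ∀ n ω, f (n + 1) ω
    ≤ f n ω - a * (c n ω / √(s (n + 1) ω)) + L / 2 * a ^ 2 * (γ n ω ^ 2 / s (n + 1) ω)
  ascent : ∀ n ω, f n ω ≤ f (n + 1) ω + a * V (n + 1) ω + L / 2 * a ^ 2
  V_step : ∀ n ω, |V (n + 1) ω - V n ω| ≤ L * a * (γ n ω / √(s (n + 1) ω))
  memLp_γ : ∀ n, MemLp (γ n) 2 μ
  condExp_c : ∀ n, μ[c n | ℱ n] =ᵐ[μ] fun ω => V n ω ^ 2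
  condExp_γ_sq : ∀ n, μ[fun ω => γ n ω ^ 2 | ℱ n] ≤ᵐ[μ] fun ω => σ₀ * V n ω ^ 2 + σ₁

namespace AdaGradRun

variable {Ω : Type*} {m0 : MeasurableSpace Ω} {μ : Measure Ω}
  {ℱ : Filtration ℕ m0} {L a σ₀ σ₁ S₀ g₁ : ℝ} {f V γ c s : ℕ → Ω → ℝ}

section Pathwise

theorem le_s (h : AdaGradRun μ ℱ L a σ₀ σ₁ S₀ g₁ f V γ c s) (n : ℕ) (ω : Ω) :
    S₀ ≤ s n ω := by
  induction n with
  | zero => exact (h.s_zero ω).ge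
  | succ n ih => rw [h.s_succ]; nlinarith [sq_nonneg (γ n ω)]

theorem s_pos (h : AdaGradRun μ ℱ L a σ₀ σ₁ S₀ g₁ f V γ c s) (n : ℕ) (ω : Ω) :
    0 < s n ω := h.S₀_pos.trans_le (h.le_s n ω)

theorem sqrt_s_mono (h : AdaGradRun μ ℱ L a σ₀ σ₁ S₀ g₁ f V γ c s) (n : ℕ) (ω : Ω) :
    √(s n ω) ≤ √(s (n + 1) ω) :=
  Real.sqrt_le_sqrt (by rw [h.s_succ]; nlinarith [sq_nonneg (γ n ω)])

theorem γ_div_le_one (h : AdaGradRun μ ℱ L a σ₀ σ₁ S₀ g₁ f V γ c s) (n : ℕ) (ω : Ω) :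
    γ n ω / √(s (n + 1) ω) ≤ 1 := by
  rw [div_le_one (Real.sqrt_pos.mpr (h.s_pos _ ω))]
  refine Real.le_sqrt_of_sq_le ?_
  rw [h.s_succ]
  linarith [h.s_pos n ω]

/-- The relative growth of the accumulator in step `n`. -/
noncomputable def ratio (γ s : ℕ → Ω → ℝ) (n : ℕ) (ω : Ω) : ℝ := γ n ω ^ 2 / s (n + 1) ω

/-- The Lyapunov function. -/
noncomputable def potential (a σ₀ σ₁ : ℝ) (f V s : ℕ → Ω → ℝ) (n : ℕ) (ω : Ω) : ℝ :=
  f n ω + 4 * a * (σ₀ * V n ω ^ 2 + σ₁) * (1 / √(s n ω))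

/-- The decrease of the Lyapunov function due to the growth of the accumulator. -/
noncomputable def decrement (a σ₀ σ₁ : ℝ) (V s : ℕ → Ω → ℝ) (n : ℕ) (ω : Ω) : ℝ :=
  4 * a * (σ₀ * V n ω ^ 2 + σ₁) * (1 / √(s n ω) - 1 / √(s (n + 1) ω))

/-- The coefficient of `ratio` in the one-step bound. -/
noncomputable def quadCoeff (L a σ₀ S₀ : ℝ) : ℝ :=
  L / 2 * a ^ 2 + 4 * σ₀ * L ^ 2 * a ^ 3 / √S₀

/-- The upper bound for the remaining increment of the Lyapunov function. -/
noncomputable def fluctuation (L a σ₀ S₀ : ℝ) (V γ c s : ℕ → Ω → ℝ) (n : ℕ) (ω : Ω) : ℝ :=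
  -a * (c n ω / √(s (n + 1) ω)) + 8 * σ₀ * L * a ^ 2 * (V n ω * γ n ω / s (n + 1) ω)
    + quadCoeff L a σ₀ S₀ * ratio γ s n ω

/-- The drift constant. -/
noncomputable def driftConst (L a σ₀ S₀ : ℝ) : ℝ :=
  quadCoeff L a σ₀ S₀ + 64 * σ₀ ^ 2 * L ^ 2 * a ^ 3 / √S₀

/-- The constant comparing consecutive values of the Lyapunov function. -/
noncomputable def backConst (L a σ₀ σ₁ S₀ : ℝ) : ℝ :=
  1 + a * L + a / 2 + L / 2 * a ^ 2
    + 4 * a * (σ₀ * (4 * L + 2 * L ^ 2 * a ^ 2) + σ₁) * (1 / √S₀)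

/-- The constant in the quadratic bound for `fluctuation`. -/
noncomputable def fluctConst (L a σ₀ S₀ : ℝ) : ℝ :=
  4 * L * (a + 8 * σ₀ * L * a ^ 2 / √S₀) ^ 2 + 2 * quadCoeff L a σ₀ S₀ ^ 2

/-- The bound for the initial value of the Lyapunov function. -/
noncomputable def initConst (L a σ₀ σ₁ S₀ g₁ : ℝ) : ℝ :=
  g₁ + 4 * a * (σ₀ * (2 * L * g₁) + σ₁) * (1 / √S₀)

variable (h : AdaGradRun μ ℱ L a σ₀ σ₁ S₀ g₁ f V γ c s)
include h

theorem inv_sqrt_le (n : ℕ) (ω : Ω) : 1 / √(s n ω) ≤ 1 / √S₀ :=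
  one_div_le_one_div_of_le (Real.sqrt_pos.mpr h.S₀_pos) (Real.sqrt_le_sqrt (h.le_s n ω))

theorem inv_sqrt_anti (n : ℕ) (ω : Ω) : 1 / √(s (n + 1) ω) ≤ 1 / √(s n ω) :=
  one_div_le_one_div_of_le (Real.sqrt_pos.mpr (h.s_pos n ω)) (h.sqrt_s_mono n ω)

theorem noise_pos (n : ℕ) (ω : Ω) : 0 < σ₀ * V n ω ^ 2 + σ₁ := by
  have := h.σ₀_pos; have := h.σ₁_pos; positivity

theorem ratio_eq (n : ℕ) (ω : Ω) : ratio γ s n ω = (γ n ω / √(s (n + 1) ω)) ^ 2 := by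
  rw [ratio, div_pow, Real.sq_sqrt (h.s_pos _ ω).le]

theorem ratio_nonneg (n : ℕ) (ω : Ω) : 0 ≤ ratio γ s n ω :=
  div_nonneg (sq_nonneg _) (h.s_pos _ ω).le

theorem ratio_le_one (n : ℕ) (ω : Ω) : ratio γ s n ω ≤ 1 := by
  rw [h.ratio_eq]
  exact pow_le_one₀ (div_nonneg (h.γ_nonneg n ω) (Real.sqrt_nonneg _)) (h.γ_div_le_one n ω)

theorem decrement_nonneg (n : ℕ) (ω : Ω) : 0 ≤ decrement a σ₀ σ₁ V s n ω := by
  have := h.a_pos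
  exact mul_nonneg (mul_nonneg (by positivity) (h.noise_pos n ω).le)
    (sub_nonneg.mpr (h.inv_sqrt_anti n ω))

theorem f_le_potential (n : ℕ) (ω : Ω) : f n ω ≤ potential a σ₀ σ₁ f V s n ω := by
  have h1 := h.a_pos
  have h2 := h.noise_pos n ω
  have : 0 ≤ 4 * a * (σ₀ * V n ω ^ 2 + σ₁) * (1 / √(s n ω)) := by positivity
  rw [potential]; linarith

theorem potential_nonneg (n : ℕ) (ω : Ω) : 0 ≤ potential a σ₀ σ₁ f V s n ω :=
  (h.f_nonneg n ω).trans (h.f_le_potential n ω)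

theorem decrement_le (n : ℕ) (ω : Ω) :
    decrement a σ₀ σ₁ V s n ω ≤ potential a σ₀ σ₁ f V s n ω := by
  have h1 := h.a_pos
  have h2 := h.noise_pos n ω
  have h3 := h.f_nonneg n ω
  have : 0 ≤ 4 * a * (σ₀ * V n ω ^ 2 + σ₁) * (1 / √(s (n + 1) ω)) := by positivity
  rw [potential, decrement, mul_sub]; linarith

theorem V_le_add (n : ℕ) (ω : Ω) : V (n + 1) ω ≤ V n ω + L * a := by
  have h1 := (abs_le.mp (h.V_step n ω)).2
  have h2 := mul_le_mul_of_nonneg_left (h.γ_div_le_one n ω) (mul_pos h.L_pos h.a_pos).le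
  linarith

theorem V_ge_sub (n : ℕ) (ω : Ω) : V n ω ≤ V (n + 1) ω + L * a := by
  have h1 := (abs_le.mp (h.V_step n ω)).1
  have h2 := mul_le_mul_of_nonneg_left (h.γ_div_le_one n ω) (mul_pos h.L_pos h.a_pos).le
  linarith

/-- A step has length at most `a`, so the gradient norm changes by at most `L * a`. The resulting
deterministic bound supplies integrability and the crude polynomial growth. -/
theorem V_le (n : ℕ) (ω : Ω) : V n ω ≤ √(2 * L * g₁) + n * (L * a) := by
  induction n with
  | zero =>
    have := h.V_sq_le 0 ω
    rw [h.f_zero] at this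
    simpa using Real.le_sqrt_of_sq_le this
  | succ n ih => push_cast; linarith [h.V_le_add n ω]

theorem f_le_add (n : ℕ) (ω : Ω) : f (n + 1) ω ≤ f n ω + a * V n ω + L / 2 * a ^ 2 := by
  have h1 := h.descent n ω
  have h2 := h.ratio_le_one n ω
  have ha := h.a_pos
  have hL := h.L_pos
  have h3 : -(c n ω / √(s (n + 1) ω)) ≤ V n ω := by
    calc -(c n ω / √(s (n + 1) ω)) = (-c n ω) / √(s (n + 1) ω) := by ring
      _ ≤ (V n ω * γ n ω) / √(s (n + 1) ω) :=
        div_le_div_of_nonneg_right ((neg_le_abs _).trans (h.abs_c_le n ω)) (Real.sqrt_nonneg _)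
      _ = V n ω * (γ n ω / √(s (n + 1) ω)) := by ring
      _ ≤ V n ω * 1 := mul_le_mul_of_nonneg_left (h.γ_div_le_one n ω) (h.V_nonneg n ω)
      _ = V n ω := mul_one _
  have h4 := mul_le_mul_of_nonneg_left h3 ha.le
  have h5 := mul_le_mul_of_nonneg_left h2 (by positivity : 0 ≤ L / 2 * a ^ 2)
  rw [ratio] at h5
  linarith

theorem exists_f_le (n : ℕ) : ∃ B, ∀ ω, f n ω ≤ B := by
  induction n with
  | zero => exact ⟨g₁, fun ω => (h.f_zero ω).le⟩
  | succ n ih =>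
    obtain ⟨B, hB⟩ := ih
    refine ⟨B + a * (√(2 * L * g₁) + n * (L * a)) + L / 2 * a ^ 2, fun ω => ?_⟩
    have := mul_le_mul_of_nonneg_left (h.V_le n ω) h.a_pos.le
    linarith [h.f_le_add n ω, hB ω]

theorem potential_le (n : ℕ) (ω : Ω) : potential a σ₀ σ₁ f V s n ω
    ≤ f n ω + 4 * a * (σ₀ * V n ω ^ 2 + σ₁) * (1 / √S₀) := by
  have h1 := h.a_pos
  have h2 := h.noise_pos n ω
  rw [potential]
  gcongr ?_ + ?_
  · exact le_rfl
  · exact mul_le_mul_of_nonneg_left (h.inv_sqrt_le n ω) (by positivity)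

theorem exists_potential_le (n : ℕ) : ∃ B, ∀ ω, potential a σ₀ σ₁ f V s n ω ≤ B := by
  obtain ⟨B, hB⟩ := h.exists_f_le n
  have := h.a_pos; have := h.L_pos; have := h.σ₀_pos
  refine ⟨B + 4 * a * (σ₀ * (2 * L * B) + σ₁) * (1 / √S₀), fun ω => (h.potential_le n ω).trans ?_⟩
  have h1 : V n ω ^ 2 ≤ 2 * L * B :=
    (h.V_sq_le n ω).trans (mul_le_mul_of_nonneg_left (hB ω) (by positivity))
  gcongr
  exact hB ω

theorem potential_zero_le (ω : Ω) :
    potential a σ₀ σ₁ f V s 0 ω ≤ initConst L a σ₀ σ₁ S₀ g₁ := by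
  have := h.a_pos; have := h.L_pos; have := h.σ₀_pos
  have h1 := h.V_sq_le 0 ω
  have h2 := h.potential_le 0 ω
  rw [h.f_zero] at h1 h2
  refine h2.trans ?_
  rw [initConst]
  gcongr

/-- Freezing `V n` while the accumulator grows produces `decrement`. The change from `V n ^ 2` to `V
(n + 1) ^ 2` at the new accumulator adds a cross term and a quadratic term, both placed in
`fluctuation`. -/
theorem potential_step (n : ℕ) (ω : Ω) : potential a σ₀ σ₁ f V s (n + 1) ω
    ≤ potential a σ₀ σ₁ f V s n ω + fluctuation L a σ₀ S₀ V γ c s n ω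
      - decrement a σ₀ σ₁ V s n ω := by
  have ha := h.a_pos
  have hL := h.L_pos
  have hσ := h.σ₀_pos
  have hV := h.V_nonneg n ω
  have hV' := h.V_nonneg (n + 1) ω
  have h0 := h.descent n ω
  have h1 := (abs_le.mp (h.V_step n ω)).2
  have hr := h.ratio_eq n ω
  have hr0 := h.ratio_nonneg n ω
  have hi := h.inv_sqrt_le (n + 1) ω
  have hp : V n ω * γ n ω / s (n + 1) ω
      = V n ω * (γ n ω / √(s (n + 1) ω)) * (1 / √(s (n + 1) ω)) := by
    rw [mul_assoc, div_mul_div_comm, mul_one, Real.mul_self_sqrt (h.s_pos _ ω).le, mul_div_assoc]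
  have hx0 : 0 ≤ γ n ω / √(s (n + 1) ω) := div_nonneg (h.γ_nonneg n ω) (Real.sqrt_nonneg _)
  simp only [potential, fluctuation, decrement, quadCoeff, hp]
  change f (n + 1) ω ≤ _ - _ + _ * ratio γ s n ω at h0
  rw [hr] at h0 ⊢
  set x := γ n ω / √(s (n + 1) ω) with hx
  set y := 1 / √(s (n + 1) ω) with hy
  have hy0 : 0 ≤ y := by positivity
  have h2 : V (n + 1) ω ^ 2 - V n ω ^ 2 ≤ 2 * (L * a) * (V n ω * x) + (L * a) ^ 2 * x ^ 2 := by
    have : V (n + 1) ω ^ 2 ≤ (V n ω + L * a * x) ^ 2 :=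
      pow_le_pow_left₀ hV' (by linarith) 2
    linarith
  have h3 := mul_le_mul_of_nonneg_left h2 (by positivity : 0 ≤ 4 * a * σ₀ * y)
  have h4 := mul_le_mul_of_nonneg_left hi (by positivity : 0 ≤ 4 * σ₀ * L ^ 2 * a ^ 3 * x ^ 2)
  have e : 4 * σ₀ * L ^ 2 * a ^ 3 / √S₀ = 4 * σ₀ * L ^ 2 * a ^ 3 * (1 / √S₀) := by ring
  rw [e]
  linarith

/-- Each term of `fluctuation` carries the factor γ/√s, whose square is `ratio`, and `V ^ 2 ≤ 2 * L
* f` is at most a multiple of the potential. -/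
theorem fluctuation_sq_le (n : ℕ) (ω : Ω) : fluctuation L a σ₀ S₀ V γ c s n ω ^ 2
    ≤ fluctConst L a σ₀ S₀ * ((potential a σ₀ σ₁ f V s n ω + 1) * ratio γ s n ω) := by
  have ha := h.a_pos
  have hL := h.L_pos
  have hσ := h.σ₀_pos
  have hS := h.S₀_pos
  have hV := h.V_nonneg n ω
  have hr := h.ratio_eq n ω
  have hr0 := h.ratio_nonneg n ω
  have hr1 := h.ratio_le_one n ω
  have hi := h.inv_sqrt_le (n + 1) ω
  have hp : V n ω * γ n ω / s (n + 1) ω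
      = V n ω * (γ n ω / √(s (n + 1) ω)) * (1 / √(s (n + 1) ω)) := by
    rw [mul_assoc, div_mul_div_comm, mul_one, Real.mul_self_sqrt (h.s_pos _ ω).le, mul_div_assoc]
  have hx0 : 0 ≤ γ n ω / √(s (n + 1) ω) := div_nonneg (h.γ_nonneg n ω) (Real.sqrt_nonneg _)
  have hc : |c n ω / √(s (n + 1) ω)| ≤ V n ω * (γ n ω / √(s (n + 1) ω)) := by
    rw [abs_div, abs_of_nonneg (Real.sqrt_nonneg _), ← mul_div_assoc]
    exact div_le_div_of_nonneg_right (h.abs_c_le n ω) (Real.sqrt_nonneg _)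
  have hVW : V n ω ^ 2 ≤ 2 * L * potential a σ₀ σ₁ f V s n ω :=
    (h.V_sq_le n ω).trans (mul_le_mul_of_nonneg_left (h.f_le_potential n ω) (by positivity))
  have hW := h.potential_nonneg n ω
  have hD : 0 ≤ quadCoeff L a σ₀ S₀ := by rw [quadCoeff]; positivity
  simp only [fluctuation, fluctConst, hp]
  set x := γ n ω / √(s (n + 1) ω) with hx
  set y := 1 / √(s (n + 1) ω) with hy
  set D := quadCoeff L a σ₀ S₀
  set ρ := ratio γ s n ω
  set w := potential a σ₀ σ₁ f V s n ω
  set E := a + 8 * σ₀ * L * a ^ 2 / √S₀ with hE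
  have hE' : E = a + 8 * σ₀ * L * a ^ 2 * (1 / √S₀) := by rw [hE]; ring
  have hy0 : 0 ≤ y := by positivity
  have hVx : 0 ≤ V n ω * x := mul_nonneg hV hx0
  have h1 : |-a * (c n ω / √(s (n + 1) ω)) + 8 * σ₀ * L * a ^ 2 * (V n ω * x * y)|
      ≤ E * (V n ω * x) := by
    refine (abs_add_le _ _).trans ?_
    rw [abs_mul, abs_neg, abs_of_pos ha,
      abs_of_nonneg (by positivity : 0 ≤ 8 * σ₀ * L * a ^ 2 * (V n ω * x * y)), hE']
    have i1 := mul_le_mul_of_nonneg_left hc ha.le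
    have i2 := mul_le_mul_of_nonneg_left hi (by positivity : 0 ≤ 8 * σ₀ * L * a ^ 2 * (V n ω * x))
    linarith
  have h2 := sq_le_sq' (abs_le.mp h1).1 (abs_le.mp h1).2
  set p := -a * (c n ω / √(s (n + 1) ω)) + 8 * σ₀ * L * a ^ 2 * (V n ω * x * y)
  have h3 : (p + D * ρ) ^ 2 ≤ 2 * p ^ 2 + 2 * D ^ 2 * ρ ^ 2 := by
    nlinarith [sq_nonneg (p - D * ρ)]
  have h4 : (E * (V n ω * x)) ^ 2 = E ^ 2 * ρ * V n ω ^ 2 := by rw [hr]; ring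
  have h5 : E ^ 2 * ρ * V n ω ^ 2 ≤ E ^ 2 * ρ * (2 * L * w) :=
    mul_le_mul_of_nonneg_left hVW (by positivity)
  have h6 : D ^ 2 * ρ ^ 2 ≤ D ^ 2 * ρ := mul_le_mul_of_nonneg_left (by nlinarith) (sq_nonneg D)
  have h7 : 0 ≤ 4 * L * E ^ 2 * ρ := by positivity
  have h8 : 0 ≤ 2 * D ^ 2 * (w * ρ) := by positivity
  linarith

theorem potential_le_back (n : ℕ) (ω : Ω) : potential a σ₀ σ₁ f V s n ω
    ≤ backConst L a σ₀ σ₁ S₀ * (potential a σ₀ σ₁ f V s (n + 1) ω + 1) := by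
  have ha := h.a_pos
  have hL := h.L_pos
  have hσ := h.σ₀_pos
  have hσ' := h.σ₁_pos
  have hS := h.S₀_pos
  have h1 := h.potential_le n ω
  have h2 := h.ascent n ω
  have h3 := h.V_ge_sub n ω
  have h4 := h.V_sq_le (n + 1) ω
  have hV := h.V_nonneg n ω
  have hf := h.f_nonneg (n + 1) ω
  have hb : 0 ≤ backConst L a σ₀ σ₁ S₀ := by rw [backConst]; positivity
  refine le_trans ?_ (mul_le_mul_of_nonneg_left
    (add_le_add_left (h.f_le_potential (n + 1) ω) 1) hb)
  have h5 : V n ω ^ 2 ≤ 4 * L * f (n + 1) ω + 2 * L ^ 2 * a ^ 2 := by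
    have := pow_le_pow_left₀ hV h3 2
    nlinarith [sq_nonneg (V (n + 1) ω - L * a)]
  have h6 : V (n + 1) ω ≤ 1 / 2 + L * f (n + 1) ω := by
    nlinarith [sq_nonneg (V (n + 1) ω - 1)]
  have h7 := mul_le_mul_of_nonneg_left h6 ha.le
  have hq : 0 ≤ 1 / √S₀ := by positivity
  have h8 := mul_le_mul_of_nonneg_left h5 (by positivity : 0 ≤ 4 * a * (1 / √S₀) * σ₀)
  rw [backConst]
  have p1 : 0 ≤ (a / 2 + L / 2 * a ^ 2) * f (n + 1) ω := by positivity
  have p2 : 0 ≤ 4 * a * (σ₀ * (2 * L ^ 2 * a ^ 2) + σ₁) * (1 / √S₀) * f (n + 1) ω := by positivity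
  have p3 : 0 ≤ 4 * a * (σ₀ * (4 * L)) * (1 / √S₀) := by positivity
  have p4 : 0 ≤ a * L := by positivity
  linarith

/-- The pathwise bound behind the drift inequality. -/
theorem drift_le (n : ℕ) (ω : Ω) :
    fluctuation L a σ₀ S₀ V γ c s n ω - decrement a σ₀ σ₁ V s n ω / 8
      - driftConst L a σ₀ S₀ * ratio γ s n ω + a / 4 * (V n ω ^ 2 / √(s n ω))
    ≤ a * (-(1 / √(s n ω)) * c n ω
      + 1 / 2 * (V n ω ^ 2 / (√(s n ω) * (σ₀ * V n ω ^ 2 + σ₁))) * γ n ω ^ 2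
      + 1 / 2 * (V n ω ^ 2 / √(s n ω))) := by
  have ha := h.a_pos
  have hL := h.L_pos
  have hσ := h.σ₀_pos
  have hu := h.noise_pos n ω
  have hV := h.V_nonneg n ω
  have hγ := h.γ_nonneg n ω
  have hc := (le_abs_self _).trans (h.abs_c_le n ω)
  have hs := h.s_pos n ω
  have hs' := h.s_pos (n + 1) ω
  have hq := h.inv_sqrt_anti n ω
  have hm := h.sqrt_s_mono n ω
  have ht0 : 0 < √S₀ := Real.sqrt_pos.mpr h.S₀_pos
  have ht0' : √S₀ ≤ √(s n ω) := Real.sqrt_le_sqrt (h.le_s n ω)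
  have e1 : s (n + 1) ω = √(s (n + 1) ω) ^ 2 := (Real.sq_sqrt hs'.le).symm
  simp only [fluctuation, decrement, driftConst, ratio]
  rw [e1, Real.sqrt_sq (Real.sqrt_nonneg _)]
  have ht : 0 < √(s n ω) := Real.sqrt_pos.mpr hs
  have ht' : 0 < √(s (n + 1) ω) := Real.sqrt_pos.mpr hs'
  set t := √(s n ω)
  set t' := √(s (n + 1) ω)
  set t₀ := √S₀
  set u := σ₀ * V n ω ^ 2 + σ₁
  set v := V n ω
  set G := γ n ω
  set q := 1 / t - 1 / t' with hqdef
  have hq0 : 0 ≤ q := sub_nonneg.mpr hq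
  -- This makes the quadratic remainder `q ^ 2 * t * u` linear in `q`, hence comparable with the
  -- telescoping decrement.
  have hqt : q * t ≤ 1 := by
    have : q * t = 1 - t / t' := by rw [hqdef]; field_simp
    have : 0 ≤ t / t' := by positivity
    linarith
  -- Young's inequality weighted by `t * u`: since `G ^ 2` has conditional mean at most `u`, the
  -- first part costs half of the descent `v ^ 2 / t`; the second, times `a`, is exactly `decrement
  -- / 8`.
  have i1 : v * G * q ≤ 1 / 2 * (v ^ 2 / (t * u)) * G ^ 2 + 1 / 2 * (u * q) := by
    have k1 : v * G * q ≤ 1 / 2 * (v ^ 2 / (t * u)) * G ^ 2 + 1 / 2 * (q ^ 2 * t * u) := by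
      have : 0 ≤ (v * G / (t * u) - q) ^ 2 * (t * u) := by positivity
      have e : (v * G / (t * u) - q) ^ 2 * (t * u)
          = (v ^ 2 / (t * u)) * G ^ 2 - 2 * (v * G * q) + q ^ 2 * t * u := by
        field_simp
        ring
      linarith
    have k2 : q ^ 2 * t * u ≤ u * q := by
      calc q ^ 2 * t * u = (q * t) * (u * q) := by ring
        _ ≤ 1 * (u * q) := mul_le_mul_of_nonneg_right hqt (by positivity)
        _ = u * q := one_mul _
    linarith
  -- Decoupling: `1 / t` is known before the step, and `q` is the error made by using it in place of
  -- `1 / t'`.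
  have i2 : -(c n ω / t') ≤ -(1 / t) * c n ω + v * G * q := by
    have := mul_le_mul_of_nonneg_right hc hq0
    have e : c n ω / t' = (1 / t) * c n ω - c n ω * q := by rw [hqdef]; ring
    linarith
  -- Of the descent `a / 2 * (v ^ 2 / t)` that remains, half is spent on the cross term; the other
  -- half is the `a / 4` on the left of the claim.
  have i3 : 8 * σ₀ * L * a ^ 2 * (v * G / t' ^ 2)
      ≤ a / 4 * (v ^ 2 / t) + 64 * σ₀ ^ 2 * L ^ 2 * a ^ 3 / t₀ * (G ^ 2 / t' ^ 2) := by
    have k1 : 8 * σ₀ * L * a ^ 2 * (v * G / t' ^ 2)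
        ≤ a / 4 * (v ^ 2 / t) + 64 * σ₀ ^ 2 * L ^ 2 * a ^ 3 * (t * (G / t' ^ 2) ^ 2) := by
      have : 0 ≤ a / t * (v / 2 - 8 * σ₀ * L * a * (t * (G / t' ^ 2))) ^ 2 := by positivity
      have e : a / t * (v / 2 - 8 * σ₀ * L * a * (t * (G / t' ^ 2))) ^ 2
          = a / 4 * (v ^ 2 / t) - 8 * σ₀ * L * a ^ 2 * (v * G / t' ^ 2)
            + 64 * σ₀ ^ 2 * L ^ 2 * a ^ 3 * (t * (G / t' ^ 2) ^ 2) := by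
        field_simp
        ring
      linarith
    have k2 : t * (G / t' ^ 2) ^ 2 ≤ 1 / t₀ * (G ^ 2 / t' ^ 2) := by
      have : t * t₀ ≤ t' ^ 2 := by nlinarith
      have e : t * (G / t' ^ 2) ^ 2 = (t / t' ^ 2) * (G ^ 2 / t' ^ 2) := by field_simp
      rw [e]
      refine mul_le_mul_of_nonneg_right ?_ (by positivity)
      rw [div_le_div_iff₀ (by positivity) ht0]
      linarith
    have k3 := mul_le_mul_of_nonneg_left k2 (by positivity : 0 ≤ 64 * σ₀ ^ 2 * L ^ 2 * a ^ 3)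
    have e : 64 * σ₀ ^ 2 * L ^ 2 * a ^ 3 / t₀ * (G ^ 2 / t' ^ 2)
        = 64 * σ₀ ^ 2 * L ^ 2 * a ^ 3 * (1 / t₀ * (G ^ 2 / t' ^ 2)) := by ring
    linarith
  have j1 := mul_le_mul_of_nonneg_left i1 ha.le
  have j2 := mul_le_mul_of_nonneg_left i2 ha.le
  linarith

/-- With t ≤ t' the two roots, the left side is (t' - t) · t(t + t')/t'², and the last factor is at
most 2. -/
theorem sqrt_mul_ratio_le (n : ℕ) (ω : Ω) :
    √(s n ω) * ratio γ s n ω ≤ 2 * (√(s (n + 1) ω) - √(s n ω)) := by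
  have hs := h.s_pos n ω
  have hs' := h.s_pos (n + 1) ω
  have hm := h.sqrt_s_mono n ω
  have e1 : s (n + 1) ω = √(s (n + 1) ω) ^ 2 := (Real.sq_sqrt hs'.le).symm
  have e2 : s n ω = √(s n ω) ^ 2 := (Real.sq_sqrt hs.le).symm
  have e3 : γ n ω ^ 2 = √(s (n + 1) ω) ^ 2 - √(s n ω) ^ 2 := by
    rw [← e1, ← e2, h.s_succ]; ring
  rw [ratio, e3]
  have ht : 0 < √(s n ω) := Real.sqrt_pos.mpr hs
  have ht' : 0 < √(s (n + 1) ω) := Real.sqrt_pos.mpr hs'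
  nth_rw 2 [e1]
  set t := √(s n ω)
  set t' := √(s (n + 1) ω)
  rw [← mul_div_assoc, div_le_iff₀ (by positivity)]
  have h1 : t * (t + t') ≤ 2 * t' ^ 2 := by nlinarith
  nlinarith [mul_le_mul_of_nonneg_left h1 (sub_nonneg.mpr hm)]

/-- Each ratio is 1 - s_n/s_{n+1} ≤ log(s_{n+1}/s_n), which telescopes. -/
theorem sum_ratio_le_log (T : ℕ) (ω : Ω) :
    ∑ n ∈ Finset.range T, ratio γ s n ω ≤ Real.log (s T ω / S₀) := by
  induction T with
  | zero => simp [h.s_zero, h.S₀_pos.ne']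
  | succ n ih =>
    rw [Finset.sum_range_succ]
    have hs := h.s_pos n ω
    have hs' := h.s_pos (n + 1) ω
    have h1 := Real.log_le_sub_one_of_pos (div_pos hs hs')
    rw [Real.log_div hs.ne' hs'.ne'] at h1
    rw [Real.log_div hs.ne' h.S₀_pos.ne'] at ih
    rw [Real.log_div hs'.ne' h.S₀_pos.ne']
    have : ratio γ s n ω = 1 - s n ω / s (n + 1) ω := by
      rw [ratio, eq_sub_iff_add_eq, ← add_div, div_eq_one_iff_eq hs'.ne', h.s_succ]; ring
    linarith

end Pathwise

end AdaGradRun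

/-! ### Measurability, integrability and expected bounds for the run. -/

namespace AdaGradRun

variable {Ω : Type*} {m0 : MeasurableSpace Ω} {μ : Measure Ω}
  {ℱ : Filtration ℕ m0} {L a σ₀ σ₁ S₀ g₁ : ℝ} {f V γ c s : ℕ → Ω → ℝ}

section Measurability

variable (h : AdaGradRun μ ℱ L a σ₀ σ₁ S₀ g₁ f V γ c s)
include h

theorem meas_sqrt_s (n : ℕ) : StronglyMeasurable[ℱ n] (fun ω => √(s n ω)) :=
  Real.continuous_sqrt.comp_stronglyMeasurable (h.meas_s n)

theorem meas_inv_sqrt (n : ℕ) : StronglyMeasurable[ℱ n] (fun ω => 1 / √(s n ω)) :=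
  (measurable_const.div (h.meas_sqrt_s n).measurable).stronglyMeasurable

theorem meas_noise (n : ℕ) : StronglyMeasurable[ℱ n] (fun ω => σ₀ * V n ω ^ 2 + σ₁) :=
  (((h.meas_V n).pow 2).const_mul σ₀).add stronglyMeasurable_const

theorem meas_ratio (n : ℕ) : StronglyMeasurable[ℱ (n + 1)] (ratio γ s n) :=
  (((h.meas_γ n).measurable.pow_const 2).div (h.meas_s (n + 1)).measurable).stronglyMeasurable

theorem meas_potential (n : ℕ) : StronglyMeasurable[ℱ n] (potential a σ₀ σ₁ f V s n) :=
  (h.meas_f n).add (((h.meas_noise n).const_mul (4 * a)).mul (h.meas_inv_sqrt n))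

theorem meas_decrement (n : ℕ) : StronglyMeasurable[ℱ (n + 1)] (decrement a σ₀ σ₁ V s n) :=
  (((h.meas_noise n).const_mul (4 * a)).mono (ℱ.mono n.le_succ)).mul
    (((h.meas_inv_sqrt n).mono (ℱ.mono n.le_succ)).sub (h.meas_inv_sqrt (n + 1)))

theorem meas_fluctuation (n : ℕ) :
    StronglyMeasurable[ℱ (n + 1)] (fluctuation L a σ₀ S₀ V γ c s n) := by
  have hV := ((h.meas_V n).mono (ℱ.mono n.le_succ)).measurable
  have hs := (h.meas_s (n + 1)).measurable
  have h1 := ((h.meas_c n).measurable.div (h.meas_sqrt_s (n + 1)).measurable).const_mul (-a)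
  have h2 := ((hV.mul (h.meas_γ n).measurable).div hs).const_mul (8 * σ₀ * L * a ^ 2)
  have h3 := (h.meas_ratio n).measurable.const_mul (quadCoeff L a σ₀ S₀)
  exact ((h1.add h2).add h3).stronglyMeasurable

variable [IsProbabilityMeasure μ]

theorem memLp_V (n : ℕ) (p : ENNReal) : MemLp (V n) p μ :=
  MemLp.of_bound ((h.meas_V n).mono (ℱ.le n)).aestronglyMeasurable
    (√(2 * L * g₁) + n * (L * a)) (ae_of_all _ fun ω => by
      rw [Real.norm_of_nonneg (h.V_nonneg n ω)]; exact h.V_le n ω)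

theorem integrable_V_sq (n : ℕ) : Integrable (fun ω => V n ω ^ 2) μ :=
  (h.memLp_V n 2).integrable_sq

theorem integrable_s (n : ℕ) : Integrable (s n) μ := by
  induction n with
  | zero =>
    rw [show s 0 = fun _ => S₀ from funext h.s_zero]
    exact integrable_const _
  | succ n ih =>
    rw [show s (n + 1) = fun ω => s n ω + γ n ω ^ 2 from funext (h.s_succ n)]
    exact ih.add (h.memLp_γ n).integrable_sq

theorem memLp_sqrt_s (n : ℕ) : MemLp (fun ω => √(s n ω)) 2 μ := by
  rw [memLp_two_iff_integrable_sq ((h.meas_sqrt_s n).mono (ℱ.le n)).aestronglyMeasurable]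
  simpa only [Real.sq_sqrt (h.s_pos n _).le] using h.integrable_s n

theorem integrable_c (n : ℕ) : Integrable (c n) μ := by
  have h1 : Integrable (fun ω => V n ω * γ n ω) μ := (h.memLp_V n 2).integrable_mul (h.memLp_γ n)
  exact h1.mono' ((h.meas_c n).mono (ℱ.le _)).aestronglyMeasurable
    (ae_of_all _ (h.abs_c_le n))

theorem memLp_V_sq_div (n : ℕ) : MemLp (fun ω => V n ω ^ 2 / √(s n ω)) 2 μ := by
  refine MemLp.of_bound (((h.meas_V n).measurable.pow_const 2).div
    (h.meas_sqrt_s n).measurable |>.stronglyMeasurable.mono (ℱ.le n)).aestronglyMeasurable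
    ((√(2 * L * g₁) + n * (L * a)) ^ 2 * (1 / √S₀)) (ae_of_all _ fun ω => ?_)
  rw [Real.norm_of_nonneg (by positivity), div_eq_mul_one_div]
  have := h.V_nonneg n ω
  gcongr ?_ ^ 2 * ?_
  · exact h.V_le n ω
  · exact h.inv_sqrt_le n ω

/-- The drift quantity of `AdaGradRun.drift_le` has nonpositive conditional expectation. -/
theorem condExp_drift_nonpos (n : ℕ) :
    μ[fun ω => -(1 / √(s n ω)) * c n ω
      + 1 / 2 * (V n ω ^ 2 / (√(s n ω) * (σ₀ * V n ω ^ 2 + σ₁))) * γ n ω ^ 2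
      + 1 / 2 * (V n ω ^ 2 / √(s n ω)) | ℱ n] ≤ᵐ[μ] 0
    ∧ Integrable (fun ω => -(1 / √(s n ω)) * c n ω
      + 1 / 2 * (V n ω ^ 2 / (√(s n ω) * (σ₀ * V n ω ^ 2 + σ₁))) * γ n ω ^ 2
      + 1 / 2 * (V n ω ^ 2 / √(s n ω))) μ := by
  have hσ := h.σ₀_pos
  have hσ' := h.σ₁_pos
  have hS := h.S₀_pos
  have m1 : StronglyMeasurable[ℱ n] (fun ω => -(1 / √(s n ω))) := (h.meas_inv_sqrt n).neg
  have m2 : StronglyMeasurable[ℱ n]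
      (fun ω => 1 / 2 * (V n ω ^ 2 / (√(s n ω) * (σ₀ * V n ω ^ 2 + σ₁)))) :=
    ((((h.meas_V n).measurable.pow_const 2).div ((h.meas_sqrt_s n).measurable.mul
      (h.meas_noise n).measurable)).const_mul (1 / 2 : ℝ)).stronglyMeasurable
  have m3 : StronglyMeasurable[ℱ n] (fun ω => 1 / 2 * (V n ω ^ 2 / √(s n ω))) :=
    ((((h.meas_V n).measurable.pow_const 2).div
      (h.meas_sqrt_s n).measurable).const_mul (1 / 2 : ℝ)).stronglyMeasurable
  have i1 : Integrable (fun ω => -(1 / √(s n ω)) * c n ω) μ := by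
    refine (h.integrable_c n).bdd_mul (c := 1 / √S₀) (m1.mono (ℱ.le n)).aestronglyMeasurable
      (ae_of_all _ fun ω => ?_)
    rw [norm_neg, Real.norm_of_nonneg (by positivity)]
    exact h.inv_sqrt_le n ω
  have i2 : Integrable
      (fun ω => 1 / 2 * (V n ω ^ 2 / (√(s n ω) * (σ₀ * V n ω ^ 2 + σ₁))) * γ n ω ^ 2) μ := by
    refine (h.memLp_γ n).integrable_sq.bdd_mul (c := 1 / 2 * (1 / √S₀ * (1 / σ₀)))
      (m2.mono (ℱ.le n)).aestronglyMeasurable (ae_of_all _ fun ω => ?_)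
    have hu := h.noise_pos n ω
    rw [Real.norm_of_nonneg (by positivity)]
    have e : V n ω ^ 2 / (√(s n ω) * (σ₀ * V n ω ^ 2 + σ₁))
        = 1 / √(s n ω) * (V n ω ^ 2 / (σ₀ * V n ω ^ 2 + σ₁)) := by
      rw [div_mul_div_comm, one_mul]
    rw [e]
    gcongr ?_ * (?_ * ?_)
    · exact h.inv_sqrt_le n ω
    · rw [div_le_div_iff₀ hu hσ]
      linarith
  have i3 : Integrable (fun ω => 1 / 2 * (V n ω ^ 2 / √(s n ω))) μ :=
    ((h.memLp_V_sq_div n).integrable one_le_two).const_mul _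
  refine ⟨?_, (i1.add i2).add i3⟩
  have e1 := condExp_mul_of_stronglyMeasurable_left (μ := μ) m1 i1 (h.integrable_c n)
  have e2 := condExp_mul_of_stronglyMeasurable_left (μ := μ) m2 i2 (h.memLp_γ n).integrable_sq
  have e3 := condExp_of_stronglyMeasurable (μ := μ) (ℱ.le n) m3 i3
  have a1 := condExp_add (μ := μ) (i1.add i2) i3 (ℱ n)
  have a2 := condExp_add (μ := μ) i1 i2 (ℱ n)
  filter_upwards [e1, e2, a1, a2, h.condExp_c n, h.condExp_γ_sq n] with ω e1 e2 a1 a2 hc hγ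
  have a3 : (μ[fun ω => -(1 / √(s n ω)) * c n ω
      + 1 / 2 * (V n ω ^ 2 / (√(s n ω) * (σ₀ * V n ω ^ 2 + σ₁))) * γ n ω ^ 2
      + 1 / 2 * (V n ω ^ 2 / √(s n ω)) | ℱ n]) ω = (-(1 / √(s n ω)) * V n ω ^ 2
      + 1 / 2 * (V n ω ^ 2 / (√(s n ω) * (σ₀ * V n ω ^ 2 + σ₁)))
        * (μ[fun ω => γ n ω ^ 2 | ℱ n]) ω) + 1 / 2 * (V n ω ^ 2 / √(s n ω)) := by
    refine a1.trans ?_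
    rw [Pi.add_apply, a2, Pi.add_apply, e3]
    congr 2
    refine e1.trans ?_
    rw [Pi.mul_apply, hc]
  rw [a3]
  · have hu := h.noise_pos n ω
    have ht : 0 < √(s n ω) := Real.sqrt_pos.mpr (h.s_pos n ω)
    -- The variance bound cancels the noise factor in the denominator, so the coefficients of `V ^ 2
    -- / √s` add up to -1 + 1/2 + 1/2 = 0.
    have k := mul_le_mul_of_nonneg_left hγ
      (by positivity : 0 ≤ 1 / 2 * (V n ω ^ 2 / (√(s n ω) * (σ₀ * V n ω ^ 2 + σ₁))))
    have e : 1 / 2 * (V n ω ^ 2 / (√(s n ω) * (σ₀ * V n ω ^ 2 + σ₁))) * (σ₀ * V n ω ^ 2 + σ₁)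
        = 1 / 2 * (V n ω ^ 2 / √(s n ω)) := by
      field_simp
    rw [e] at k
    have e' : -(1 / √(s n ω)) * V n ω ^ 2 = -(V n ω ^ 2 / √(s n ω)) := by ring
    rw [e', Pi.zero_apply]
    linarith

theorem memLp_potential (n : ℕ) : MemLp (potential a σ₀ σ₁ f V s n) 2 μ := by
  obtain ⟨B, hB⟩ := h.exists_potential_le n
  exact MemLp.of_bound ((h.meas_potential n).mono (ℱ.le n)).aestronglyMeasurable B
    (ae_of_all _ fun ω => by rw [Real.norm_of_nonneg (h.potential_nonneg n ω)]; exact hB ω)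

theorem memLp_decrement (n : ℕ) : MemLp (decrement a σ₀ σ₁ V s n) 2 μ := by
  obtain ⟨B, hB⟩ := h.exists_potential_le n
  exact MemLp.of_bound ((h.meas_decrement n).mono (ℱ.le _)).aestronglyMeasurable B
    (ae_of_all _ fun ω => by
      rw [Real.norm_of_nonneg (h.decrement_nonneg n ω)]; exact (h.decrement_le n ω).trans (hB ω))

theorem memLp_ratio (n : ℕ) : MemLp (ratio γ s n) 2 μ :=
  MemLp.of_bound ((h.meas_ratio n).mono (ℱ.le _)).aestronglyMeasurable 1
    (ae_of_all _ fun ω => by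
      rw [Real.norm_of_nonneg (h.ratio_nonneg n ω)]; exact h.ratio_le_one n ω)

omit [IsProbabilityMeasure μ] in
theorem fluctConst_nonneg : 0 ≤ fluctConst L a σ₀ S₀ := by
  have := h.L_pos
  rw [fluctConst]; positivity

theorem memLp_fluctuation (n : ℕ) : MemLp (fluctuation L a σ₀ S₀ V γ c s n) 2 μ := by
  obtain ⟨B, hB⟩ := h.exists_potential_le n
  refine MemLp.of_bound ((h.meas_fluctuation n).mono (ℱ.le _)).aestronglyMeasurable
    (√(fluctConst L a σ₀ S₀ * (B + 1))) (ae_of_all _ fun ω =>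
      Real.abs_le_sqrt ((h.fluctuation_sq_le n ω).trans ?_))
  refine mul_le_mul_of_nonneg_left ?_ h.fluctConst_nonneg
  nlinarith [h.ratio_le_one n ω, h.ratio_nonneg n ω, h.potential_nonneg n ω, hB ω]

theorem memLp_drift (n : ℕ) : MemLp (fun ω => fluctuation L a σ₀ S₀ V γ c s n ω
    - decrement a σ₀ σ₁ V s n ω / 8 - driftConst L a σ₀ S₀ * ratio γ s n ω) 2 μ :=
  ((h.memLp_fluctuation n).sub ((h.memLp_decrement n).mul_const (8⁻¹ : ℝ))).sub
    ((h.memLp_ratio n).const_mul _)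

/-- The retained descent term is discarded for `driftControlled` but is the source of the gradient
bound in `integral_V_sq_step`. -/
theorem condExp_increment_nonpos (n : ℕ) :
    μ[fun ω => fluctuation L a σ₀ S₀ V γ c s n ω - decrement a σ₀ σ₁ V s n ω / 8
      - driftConst L a σ₀ S₀ * ratio γ s n ω + a / 4 * (V n ω ^ 2 / √(s n ω)) | ℱ n]
      ≤ᵐ[μ] 0 := by
  obtain ⟨h1, i1⟩ := h.condExp_drift_nonpos n
  have i2 := ((h.memLp_drift n).add ((h.memLp_V_sq_div n).const_mul (a / 4))).integrable one_le_two
  have h2 := condExp_mono (μ := μ) (m := ℱ n) i2 (i1.const_mul a) (ae_of_all _ (h.drift_le n))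
  have h3 := condExp_smul (μ := μ) a (fun ω => -(1 / √(s n ω)) * c n ω
      + 1 / 2 * (V n ω ^ 2 / (√(s n ω) * (σ₀ * V n ω ^ 2 + σ₁))) * γ n ω ^ 2
      + 1 / 2 * (V n ω ^ 2 / √(s n ω))) (ℱ n)
  filter_upwards [h1, h2, h3] with ω h1 h2 h3
  refine h2.trans (h3.le.trans ?_)
  exact mul_nonpos_of_nonneg_of_nonpos h.a_pos.le h1

theorem driftControlled : DriftControlled μ ℱ (driftConst L a σ₀ S₀) (backConst L a σ₀ σ₁ S₀)
    (fluctConst L a σ₀ S₀) (initConst L a σ₀ σ₁ S₀ g₁) (potential a σ₀ σ₁ f V s)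
    (decrement a σ₀ σ₁ V s) (fluctuation L a σ₀ S₀ V γ c s) (ratio γ s) where
  meas_W := h.meas_potential
  meas_N := h.meas_decrement
  meas_R := h.meas_fluctuation
  meas_r := h.meas_ratio
  bdd_W := h.exists_potential_le
  W_zero_le := h.potential_zero_le
  W_nonneg := h.potential_nonneg
  N_nonneg := h.decrement_nonneg
  N_le := h.decrement_le
  r_nonneg := h.ratio_nonneg
  r_le_one := h.ratio_le_one
  step := h.potential_step
  R_sq_le := h.fluctuation_sq_le
  back := h.potential_le_back
  drift n := by
    have ha := h.a_pos
    refine (condExp_mono ((h.memLp_drift n).integrable one_le_two)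
      (((h.memLp_drift n).add ((h.memLp_V_sq_div n).const_mul (a / 4))).integrable one_le_two)
      (ae_of_all _ fun ω => ?_)).trans (h.condExp_increment_nonpos n)
    have : 0 ≤ a / 4 * (V n ω ^ 2 / √(s n ω)) := by positivity
    change _ ≤ _ + a / 4 * (V n ω ^ 2 / √(s n ω))
    linarith

omit [IsProbabilityMeasure μ] in
theorem meas_sqrt_diff (n : ℕ) :
    StronglyMeasurable[ℱ (n + 1)] (fun ω => √(s (n + 1) ω) - √(s n ω)) :=
  (h.meas_sqrt_s (n + 1)).sub ((h.meas_sqrt_s n).mono (ℱ.mono n.le_succ))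

/-- The weight `√(s n)` is known before step `n`, so it multiplies the drift inequality and clears
the denominator of the descent term. Rewriting `√(s n) * W (n + 1)` with `√(s (n + 1))` prepares the
telescoping. -/
theorem integral_V_sq_step (n : ℕ) :
    a / 4 * ∫ ω, V n ω ^ 2 ∂μ
      ≤ (∫ ω, √(s n ω) * potential a σ₀ σ₁ f V s n ω ∂μ
          - ∫ ω, √(s (n + 1) ω) * potential a σ₀ σ₁ f V s (n + 1) ω ∂μ)
        + ∫ ω, potential a σ₀ σ₁ f V s (n + 1) ω * (√(s (n + 1) ω) - √(s n ω)) ∂μ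
        + 2 * driftConst L a σ₀ S₀ * (∫ ω, √(s (n + 1) ω) ∂μ - ∫ ω, √(s n ω) ∂μ) := by
  have ha := h.a_pos
  have hL := h.L_pos
  have hσ := h.σ₀_pos
  have hD : 0 ≤ driftConst L a σ₀ S₀ := by rw [driftConst, quadCoeff]; positivity
  have hX : MemLp (fun ω => fluctuation L a σ₀ S₀ V γ c s n ω - decrement a σ₀ σ₁ V s n ω / 8
      - driftConst L a σ₀ S₀ * ratio γ s n ω + a / 4 * (V n ω ^ 2 / √(s n ω))) 2 μ :=
    (h.memLp_drift n).add ((h.memLp_V_sq_div n).const_mul (a / 4))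
  have h0 := integral_mul_nonpos_of_condExp_nonpos (ℱ.le n) (h.meas_sqrt_s n) (h.memLp_sqrt_s n)
    hX (fun ω => Real.sqrt_nonneg _) (h.condExp_increment_nonpos n)
  have iX : Integrable (fun ω => √(s n ω) * (fluctuation L a σ₀ S₀ V γ c s n ω
      - decrement a σ₀ σ₁ V s n ω / 8
      - driftConst L a σ₀ S₀ * ratio γ s n ω + a / 4 * (V n ω ^ 2 / √(s n ω)))) μ :=
    (h.memLp_sqrt_s n).integrable_mul hX
  have i1 : Integrable (fun ω => √(s n ω) * potential a σ₀ σ₁ f V s n ω) μ :=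
    (h.memLp_sqrt_s n).integrable_mul (h.memLp_potential n)
  have i2 : Integrable (fun ω => √(s (n + 1) ω) * potential a σ₀ σ₁ f V s (n + 1) ω) μ :=
    (h.memLp_sqrt_s (n + 1)).integrable_mul (h.memLp_potential (n + 1))
  have i3 : Integrable (fun ω => potential a σ₀ σ₁ f V s (n + 1) ω
      * (√(s (n + 1) ω) - √(s n ω))) μ :=
    (h.memLp_potential (n + 1)).integrable_mul ((h.memLp_sqrt_s (n + 1)).sub (h.memLp_sqrt_s n))
  have i4 := (h.memLp_sqrt_s (n + 1)).integrable one_le_two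
  have i5 := (h.memLp_sqrt_s n).integrable one_le_two
  have i12 : Integrable (fun ω => √(s n ω) * potential a σ₀ σ₁ f V s n ω
      - √(s (n + 1) ω) * potential a σ₀ σ₁ f V s (n + 1) ω) μ := i1.sub i2
  have i45 : Integrable (fun ω => √(s (n + 1) ω) - √(s n ω)) μ := i4.sub i5
  have i123 : Integrable (fun ω => (√(s n ω) * potential a σ₀ σ₁ f V s n ω
      - √(s (n + 1) ω) * potential a σ₀ σ₁ f V s (n + 1) ω)
      + potential a σ₀ σ₁ f V s (n + 1) ω * (√(s (n + 1) ω) - √(s n ω))) μ := i12.add i3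
  rw [← integral_sub i1 i2, ← integral_sub i4 i5, ← integral_add i12 i3]
  have key := integral_le_linearCombination (h.integrable_V_sq n |>.const_mul (a / 4)) i123 i45 iX
    1 (2 * driftConst L a σ₀ S₀) 1 fun ω => ?_
  · rw [integral_const_mul] at key
    linarith
  have b1 := h.potential_step n ω
  have b2 := mul_le_mul_of_nonneg_left (h.sqrt_mul_ratio_le n ω) hD
  have b3 := h.decrement_nonneg n ω
  have ht : 0 < √(s n ω) := Real.sqrt_pos.mpr (h.s_pos n ω)
  have b4 : potential a σ₀ σ₁ f V s (n + 1) ω ≤ potential a σ₀ σ₁ f V s n ω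
      + fluctuation L a σ₀ S₀ V γ c s n ω - decrement a σ₀ σ₁ V s n ω / 8 := by linarith
  have b5 := mul_le_mul_of_nonneg_left b4 ht.le
  have b6 : √(s n ω) * (a / 4 * (V n ω ^ 2 / √(s n ω))) = a / 4 * V n ω ^ 2 := by field_simp
  linarith

/-- Summation by parts: the squared gradients are controlled by the majorant and the
accumulator. -/
theorem sum_integral_V_sq_le (T : ℕ) :
    a / 4 * ∑ n ∈ Finset.range T, ∫ ω, V n ω ^ 2 ∂μ
      ≤ √S₀ * initConst L a σ₀ σ₁ S₀ g₁
        + ∫ ω, DriftControlled.majorant μ ℱ (driftConst L a σ₀ S₀) (initConst L a σ₀ σ₁ S₀ g₁)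
          (decrement a σ₀ σ₁ V s) (fluctuation L a σ₀ S₀ V γ c s) (ratio γ s) T ω
          * (√(s T ω) - √S₀) ∂μ
        + 2 * driftConst L a σ₀ S₀ * ∫ ω, √(s T ω) ∂μ := by
  have ha := h.a_pos
  have hL := h.L_pos
  have hσ := h.σ₀_pos
  have hD : 0 ≤ driftConst L a σ₀ S₀ := by rw [driftConst, quadCoeff]; positivity
  have h1 := h.driftControlled.sum_integral_mul_le hD h.fluctConst_nonneg
    (Z := fun n ω => √(s (n + 1) ω) - √(s n ω)) h.meas_sqrt_diff
    (fun n => (h.memLp_sqrt_s (n + 1)).sub (h.memLp_sqrt_s n))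
    (fun n ω => sub_nonneg.mpr (h.sqrt_s_mono n ω)) T
  have e1 : ∀ ω, ∑ n ∈ Finset.range T, (√(s (n + 1) ω) - √(s n ω)) = √(s T ω) - √S₀ := by
    intro ω
    rw [Finset.sum_range_sub (fun n => √(s n ω)), h.s_zero]
  simp only [e1] at h1
  have h2 := Finset.sum_le_sum fun n (_ : n ∈ Finset.range T) => h.integral_V_sq_step n
  rw [← Finset.mul_sum, Finset.sum_add_distrib, Finset.sum_add_distrib, ← Finset.mul_sum,
    Finset.sum_range_sub' (fun n => ∫ ω, √(s n ω) * potential a σ₀ σ₁ f V s n ω ∂μ),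
    Finset.sum_range_sub (fun n => ∫ ω, √(s n ω) ∂μ)] at h2
  have h3 : 0 ≤ ∫ ω, √(s T ω) * potential a σ₀ σ₁ f V s T ω ∂μ :=
    integral_nonneg fun ω => mul_nonneg (Real.sqrt_nonneg _) (h.potential_nonneg T ω)
  have h4 : 0 ≤ ∫ ω, √(s 0 ω) ∂μ := integral_nonneg fun ω => Real.sqrt_nonneg _
  have h5 : ∫ ω, √(s 0 ω) * potential a σ₀ σ₁ f V s 0 ω ∂μ
      ≤ √S₀ * initConst L a σ₀ σ₁ S₀ g₁ := by
    have := integral_mono ((h.memLp_sqrt_s 0).integrable_mul (h.memLp_potential 0))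
      (integrable_const (√S₀ * initConst L a σ₀ σ₁ S₀ g₁)) fun ω => by
        change √(s 0 ω) * potential a σ₀ σ₁ f V s 0 ω ≤ _
        rw [h.s_zero]
        exact mul_le_mul_of_nonneg_left (h.potential_zero_le ω) (Real.sqrt_nonneg _)
    simpa using this
  have h6 := mul_nonneg hD h4
  linarith

theorem integral_s_le (T : ℕ) : ∫ ω, s T ω ∂μ
    ≤ S₀ + σ₀ * ∑ n ∈ Finset.range T, ∫ ω, V n ω ^ 2 ∂μ + σ₁ * T := by
  induction T with
  | zero => simp [h.s_zero]
  | succ n ih =>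
    rw [Finset.sum_range_succ]
    have e : ∫ ω, s (n + 1) ω ∂μ = ∫ ω, s n ω ∂μ + ∫ ω, γ n ω ^ 2 ∂μ := by
      rw [← integral_add (h.integrable_s n) (h.memLp_γ n).integrable_sq]
      exact integral_congr_ae (ae_of_all _ (h.s_succ n))
    have h1 : ∫ ω, γ n ω ^ 2 ∂μ ≤ σ₀ * ∫ ω, V n ω ^ 2 ∂μ + σ₁ := by
      have i : Integrable (fun ω => σ₀ * V n ω ^ 2) μ := (h.integrable_V_sq n).const_mul _
      have : ∫ _ω : Ω, σ₁ ∂μ = σ₁ := by simp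
      rw [← integral_condExp (μ := μ) (ℱ.le n), ← integral_const_mul]
      rw [← this, ← integral_add i (integrable_const _)]
      exact integral_mono_ae integrable_condExp (i.add (integrable_const _)) (h.condExp_γ_sq n)
    push_cast
    linarith

/-- A crude bound suffices here, since it only enters through a logarithm. -/
theorem sum_integral_V_sq_le_cube (T : ℕ) (hT : 1 ≤ T) :
    ∑ n ∈ Finset.range T, ∫ ω, V n ω ^ 2 ∂μ
      ≤ (4 * L * g₁ + 2 * (L * a) ^ 2) * (T : ℝ) ^ 3 := by
  have hL := h.L_pos
  have ha := h.a_pos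
  have hT1 : (1 : ℝ) ≤ T := by exact_mod_cast hT
  have hg : 0 ≤ g₁ := by
    obtain ⟨ω⟩ := nonempty_of_isProbabilityMeasure μ
    rw [← h.f_zero ω]; exact h.f_nonneg 0 ω
  have key : ∀ n ∈ Finset.range T, ∫ ω, V n ω ^ 2 ∂μ
      ≤ (4 * L * g₁ + 2 * (L * a) ^ 2) * (T : ℝ) ^ 2 := by
    intro n hn
    have hn' : (n : ℝ) ≤ T := by exact_mod_cast (Finset.mem_range.mp hn).le
    have := integral_mono (h.integrable_V_sq n)
      (integrable_const ((4 * L * g₁ + 2 * (L * a) ^ 2) * (T : ℝ) ^ 2)) fun ω => by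
        have h1 := pow_le_pow_left₀ (h.V_nonneg n ω) (h.V_le n ω) 2
        have h2 : √(2 * L * g₁) ^ 2 = 2 * L * g₁ := Real.sq_sqrt (by positivity)
        have h3 : (n * (L * a)) ^ 2 ≤ (T : ℝ) ^ 2 * (L * a) ^ 2 := by
          rw [mul_pow]; gcongr
        have h4 : 4 * L * g₁ * 1 ≤ 4 * L * g₁ * (T : ℝ) ^ 2 :=
          mul_le_mul_of_nonneg_left (one_le_pow₀ hT1) (by positivity)
        change V n ω ^ 2 ≤ _
        nlinarith [sq_nonneg (√(2 * L * g₁) - n * (L * a))]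
    simpa using this
  refine (Finset.sum_le_card_nsmul _ _ _ key).trans ?_
  rw [Finset.card_range, nsmul_eq_mul]
  exact le_of_eq (by ring)

end Measurability

end AdaGradRun

/-! ### Logarithmic estimates and the self-bounding inequality. -/

theorem log_le_two_mul_sqrt {x : ℝ} (hx : 0 < x) : Real.log x ≤ 2 * √x := by
  have h1 := Real.log_le_sub_one_of_pos (Real.sqrt_pos.mpr hx)
  rw [Real.log_sqrt hx.le] at h1
  linarith

/-- Above the threshold `l`, the excess log(x/l) is at most 2√(x/l). After integration, the second
moment of a logarithm is thus controlled by a first moment. -/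
theorem log_sq_le {x l : ℝ} (hx : 1 ≤ x) (hl : 1 ≤ l) :
    Real.log x ^ 2 ≤ 2 * Real.log l ^ 2 + 8 * (x / l) := by
  have hx0 : 0 < x := by linarith
  have hl0 : 0 < l := by linarith
  have h1 := Real.log_nonneg hx
  have h2 := Real.log_nonneg hl
  have hy : 0 < x / l := div_pos hx0 hl0
  rcases le_total x l with h | h
  · have := pow_le_pow_left₀ h1 (Real.log_le_log hx0 h) 2
    nlinarith [sq_nonneg (Real.log l)]
  · have h3 := log_le_two_mul_sqrt hy
    rw [Real.log_div hx0.ne' hl0.ne'] at h3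
    have h4 := pow_le_pow_left₀ h1 (by linarith : Real.log x ≤ Real.log l + 2 * √(x / l)) 2
    have h5 := Real.sq_sqrt hy.le
    nlinarith [sq_nonneg (Real.log l - 2 * √(x / l))]

/-- `X` recurs under the root; Young's inequality absorbs half of the left side, and `l ≤ 2 * t`
turns the leftover `l ^ 2` into `t * l`. -/
theorem le_of_le_add_mul_sqrt {a P Q B D X l t m : ℝ} (ha : 0 < a) (hP : 0 ≤ P) (hQ : 0 ≤ Q)
    (hB : 0 ≤ B) (hD : 0 ≤ D) (hX : 0 ≤ X) (hl : 1 / 2 ≤ l) (ht : 1 ≤ t) (hlt : l ≤ 2 * t)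
    (hm : m ≤ B * t ^ 2 + D * X) (h : a / 4 * X ≤ P + Q * l * √m) :
    X ≤ 8 / a * (2 * P + Q * √B + 4 / a * Q ^ 2 * D) * (t * l) := by
  have h1 : √m ≤ √B * t + √D * √X := by
    refine Real.sqrt_le_iff.mpr ⟨by positivity, hm.trans ?_⟩
    have e1 := Real.sq_sqrt hB
    have e2 := Real.sq_sqrt hD
    have e3 := Real.sq_sqrt hX
    have : 0 ≤ (√B * t) * (√D * √X) := by positivity
    calc B * t ^ 2 + D * X = (√B * t) ^ 2 + (√D * √X) ^ 2 := by rw [mul_pow, mul_pow, e1, e2, e3]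
      _ ≤ _ := by nlinarith
  have hl0 : 0 ≤ l := by linarith
  have h2 : Q * l * √m ≤ Q * l * (√B * t + √D * √X) :=
    mul_le_mul_of_nonneg_left h1 (by positivity)
  have h3 : Q * l * (√D * √X) ≤ a / 8 * X + 2 / a * Q ^ 2 * D * l ^ 2 := by
    have : 0 ≤ (a / 4 * √X - Q * l * √D) ^ 2 * (2 / a) := by positivity
    have e : (a / 4 * √X - Q * l * √D) ^ 2 * (2 / a)
        = a / 8 * √X ^ 2 - Q * l * (√D * √X) + 2 / a * Q ^ 2 * √D ^ 2 * l ^ 2 := by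
      field_simp
      ring
    rw [Real.sq_sqrt hX, Real.sq_sqrt hD] at e
    linarith
  have h4 : l ^ 2 ≤ 2 * (t * l) := by nlinarith
  have h5 : 1 ≤ 2 * (t * l) := by nlinarith
  have h6 := mul_le_mul_of_nonneg_left h4 (by positivity : 0 ≤ 2 / a * Q ^ 2 * D)
  have h7 := mul_le_mul_of_nonneg_left h5 hP
  have h8 : a / 8 * X ≤ (2 * P + Q * √B + 4 / a * Q ^ 2 * D) * (t * l) := by
    have e : 2 / a * Q ^ 2 * D * (2 * (t * l)) = 4 / a * Q ^ 2 * D * (t * l) := by ring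
    linarith
  have h9 := mul_le_mul_of_nonneg_left h8 (by positivity : 0 ≤ 8 / a)
  have e : 8 / a * (a / 8 * X) = X := by field_simp
  linarith

theorem half_le_log {T : ℕ} (hT : 2 ≤ T) : 1 / 2 ≤ Real.log T := by
  have h1 := Real.log_le_log (by norm_num) (show (2 : ℝ) ≤ T by exact_mod_cast hT)
  have h2 := Real.log_two_gt_d9
  linarith

namespace AdaGradRun

/-- If the mean of the accumulator grows polynomially, then the second moment of the sum of the
ratios grows like `log T ^ 2`. -/
theorem integral_sum_ratio_sq_le {Ω : Type*} {m0 : MeasurableSpace Ω} {μ : Measure Ω}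
    [IsProbabilityMeasure μ] {ℱ : Filtration ℕ m0} {L a σ₀ σ₁ S₀ g₁ : ℝ}
    {f V γ c s : ℕ → Ω → ℝ} (h : AdaGradRun μ ℱ L a σ₀ σ₁ S₀ g₁ f V γ c s) {M : ℝ}
    (hM0 : 0 < M) {T : ℕ} (hT : 2 ≤ T) (hmM : ∫ ω, s T ω ∂μ ≤ M * (T : ℝ) ^ 3) :
    ∫ ω, (∑ n ∈ Finset.range T, ratio γ s n ω) ^ 2 ∂μ
      ≤ 2 * ((3 + 2 * Real.log (1 + M / S₀)) * Real.log T) ^ 2 + 8 := by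
  have hS₀ := h.S₀_pos
  have hMS : 1 ≤ 1 + M / S₀ := le_add_of_nonneg_right (by positivity)
  have hl2 := half_le_log hT
  have hT2 : (2 : ℝ) ≤ T := by exact_mod_cast hT
  set b := Real.log (1 + M / S₀) with hb
  set l := Real.log T with hl
  set m := ∫ ω, s T ω ∂μ
  have hb0 : 0 ≤ b := Real.log_nonneg hMS
  -- Chosen so that `S₀ * lam = (S₀ + M) * T ^ 3` exceeds the mean of `s T`: the linear remainder
  -- then costs at most 8.
  set lam := (T : ℝ) ^ 3 * (1 + M / S₀) with hlam
  have hT3 : (1 : ℝ) ≤ (T : ℝ) ^ 3 := one_le_pow₀ (by linarith)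
  have hlam1 : 1 ≤ lam := one_le_mul_of_one_le_of_one_le hT3 hMS
  have hlog : Real.log lam = 3 * l + b := by
    rw [hlam, Real.log_mul (by positivity) (by positivity), Real.log_pow]
    norm_num [hl, hb]
  have i1 : Integrable (fun ω => 8 / (S₀ * lam) * s T ω) μ := (h.integrable_s T).const_mul _
  have e1 : ∫ ω, (2 * Real.log lam ^ 2 + 8 / (S₀ * lam) * s T ω) ∂μ
      = 2 * Real.log lam ^ 2 + 8 / (S₀ * lam) * m := by
    rw [integral_add (integrable_const _) i1, integral_const_mul (8 / (S₀ * lam)) (s T),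
      integral_const]
    simp [m]
  have h1 : ∫ ω, (∑ n ∈ Finset.range T, ratio γ s n ω) ^ 2 ∂μ
      ≤ 2 * Real.log lam ^ 2 + 8 / (S₀ * lam) * m := by
    rw [← e1]
    refine integral_mono (h.driftControlled.memLp_sum_r T).integrable_sq
      ((integrable_const _).add i1) fun ω => ?_
    change (∑ n ∈ Finset.range T, ratio γ s n ω) ^ 2
      ≤ 2 * Real.log lam ^ 2 + 8 / (S₀ * lam) * s T ω
    refine (pow_le_pow_left₀ (Finset.sum_nonneg fun n _ => h.ratio_nonneg n ω)
      (h.sum_ratio_le_log T ω) 2).trans ?_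
    have := log_sq_le ((one_le_div hS₀).mpr (h.le_s T ω)) hlam1
    have e : 8 * (s T ω / S₀ / lam) = 8 / (S₀ * lam) * s T ω := by
      field_simp
    linarith
  have h2 : 8 / (S₀ * lam) * m ≤ 8 := by
    have hd : 0 < S₀ * lam := by positivity
    rw [div_mul_eq_mul_div, div_le_iff₀ hd]
    have e : S₀ * lam = (S₀ + M) * (T : ℝ) ^ 3 := by
      rw [hlam]
      field_simp
    rw [e]
    nlinarith
  have h3 : Real.log lam ^ 2 ≤ ((3 + 2 * b) * l) ^ 2 := by
    refine pow_le_pow_left₀ (Real.log_nonneg hlam1) ?_ 2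
    rw [hlog]
    nlinarith
  linarith

/-- The expected sum of squared gradients grows at most like `√T * log T`. -/
theorem exists_sum_integral_V_sq_le {L a σ₀ σ₁ S₀ g₁ : ℝ} (hL : 0 < L) (ha : 0 < a)
    (hσ₀ : 0 < σ₀) (hσ₁ : 0 < σ₁) (hS₀ : 0 < S₀) (hg₁ : 0 ≤ g₁) :
    ∃ C : ℝ, 0 ≤ C ∧ ∀ {Ω : Type*} {m0 : MeasurableSpace Ω} {μ : Measure Ω}
      [IsProbabilityMeasure μ] {ℱ : Filtration ℕ m0} {f V γ c s : ℕ → Ω → ℝ},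
      AdaGradRun μ ℱ L a σ₀ σ₁ S₀ g₁ f V γ c s → ∀ T : ℕ, 2 ≤ T →
      ∑ n ∈ Finset.range T, ∫ ω, V n ω ^ 2 ∂μ ≤ C * (√T * Real.log T) := by
  have hC₁ : 0 ≤ driftConst L a σ₀ S₀ := by rw [driftConst, quadCoeff]; positivity
  have hC₂ : 0 ≤ backConst L a σ₀ σ₁ S₀ := by rw [backConst]; positivity
  have hC₃ : 0 ≤ fluctConst L a σ₀ S₀ := by rw [fluctConst]; positivity
  have hw : 0 ≤ initConst L a σ₀ σ₁ S₀ g₁ := by rw [initConst]; positivity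
  obtain ⟨K, hK, hY⟩ := DriftControlled.integral_majorant_sq_le (driftConst L a σ₀ S₀)
    (backConst L a σ₀ σ₁ S₀) (fluctConst L a σ₀ S₀) (initConst L a σ₀ σ₁ S₀ g₁) hC₁ hC₂ hC₃
  set M := S₀ + σ₀ * (4 * L * g₁ + 2 * (L * a) ^ 2) + σ₁ with hM
  have hM0 : 0 < M := by positivity
  set b := Real.log (1 + M / S₀) with hb
  have hMS : 1 ≤ 1 + M / S₀ := le_add_of_nonneg_right (by positivity)
  have hb0 : 0 ≤ b := Real.log_nonneg hMS
  -- The 36 absorbs the constant 9 = 1 + 8, because `l ≥ 1 / 2`.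
  set A := 2 * (3 + 2 * b) ^ 2 + 36 with hA
  have hA0 : 0 ≤ A := by positivity
  refine ⟨8 / a * (2 * (√S₀ * initConst L a σ₀ σ₁ S₀ g₁)
    + (√(K * A) + 4 * driftConst L a σ₀ S₀) * √(S₀ + σ₁)
    + 4 / a * (√(K * A) + 4 * driftConst L a σ₀ S₀) ^ 2 * σ₀), by positivity, ?_⟩
  intro Ω m0 μ _ ℱ f V γ c s h T hT
  have hT2 : (2 : ℝ) ≤ T := by exact_mod_cast hT
  have hT0 : (0 : ℝ) < T := by linarith
  set l := Real.log T with hl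
  have hl2 : 1 / 2 ≤ l := half_le_log hT
  have ht1 : 1 ≤ √(T : ℝ) := Real.one_le_sqrt.mpr (by linarith)
  have hlt : l ≤ 2 * √(T : ℝ) := log_le_two_mul_sqrt hT0
  set X := ∑ n ∈ Finset.range T, ∫ ω, V n ω ^ 2 ∂μ with hXdef
  have hX0 : 0 ≤ X := Finset.sum_nonneg fun n _ => integral_nonneg fun ω => sq_nonneg _
  have hs := h.integral_s_le T
  have hcube := h.sum_integral_V_sq_le_cube T (by omega)
  have hmain := h.sum_integral_V_sq_le T
  have hY := hY h.driftControlled T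
  rw [← hXdef] at hs hcube hmain
  set Y := DriftControlled.majorant μ ℱ (driftConst L a σ₀ S₀) (initConst L a σ₀ σ₁ S₀ g₁)
    (decrement a σ₀ σ₁ V s) (fluctuation L a σ₀ S₀ V γ c s) (ratio γ s) T
  set m := ∫ ω, s T ω ∂μ
  have hYL : MemLp Y 2 μ := h.driftControlled.memLp_majorant hC₃ T
  have hsq : ∀ ω, √(s T ω) ^ 2 = s T ω := fun ω => Real.sq_sqrt (h.s_pos T ω).le
  have hmM : m ≤ M * (T : ℝ) ^ 3 := by
    have h1 : (1 : ℝ) ≤ (T : ℝ) ^ 3 := one_le_pow₀ (by linarith)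
    have h2 : (T : ℝ) ≤ (T : ℝ) ^ 3 := le_self_pow₀ (by linarith) (by norm_num)
    have h3 := mul_le_mul_of_nonneg_left h1 hS₀.le
    have h4 := mul_le_mul_of_nonneg_left h2 hσ₁.le
    have h5 := mul_le_mul_of_nonneg_left hcube hσ₀.le
    rw [hM]
    linarith
  have hρ := h.integral_sum_ratio_sq_le hM0 hT hmM
  have hY2 : √(∫ ω, Y ω ^ 2 ∂μ) ≤ √(K * A) * l := by
    refine Real.sqrt_le_iff.mpr ⟨by positivity, hY.trans ?_⟩
    rw [mul_pow, Real.sq_sqrt (by positivity), mul_assoc]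
    refine mul_le_mul_of_nonneg_left ?_ hK
    have h1 : 9 ≤ 36 * l ^ 2 := by nlinarith
    have h2 : A * l ^ 2 = 2 * ((3 + 2 * b) * l) ^ 2 + 36 * l ^ 2 := by rw [hA]; ring
    linarith
  have hm0 : 0 ≤ m := integral_nonneg fun ω => (h.s_pos T ω).le
  have hroot : ∫ ω, √(s T ω) ∂μ ≤ √m := by
    have := integral_mul_le_sqrt_mul_sqrt (memLp_const (1 : ℝ)) (h.memLp_sqrt_s T)
    simpa [hsq] using this
  have hdiff : MemLp (fun ω => √(s T ω) - √S₀) 2 μ := (h.memLp_sqrt_s T).sub (memLp_const _)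
  have hYs : ∫ ω, Y ω * (√(s T ω) - √S₀) ∂μ ≤ √(K * A) * l * √m := by
    refine (integral_mul_le_sqrt_mul_sqrt hYL hdiff).trans ?_
    refine mul_le_mul hY2 (Real.sqrt_le_sqrt ?_) (Real.sqrt_nonneg _) (by positivity)
    refine integral_mono hdiff.integrable_sq (h.integrable_s T) fun ω => ?_
    have h1 : √S₀ ≤ √(s T ω) := Real.sqrt_le_sqrt (h.le_s T ω)
    have h2 := Real.sqrt_nonneg S₀
    change (√(s T ω) - √S₀) ^ 2 ≤ s T ω
    exact (pow_le_pow_left₀ (by linarith) (by linarith) 2).trans (hsq ω).le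
  refine le_of_le_add_mul_sqrt (m := m) ha (by positivity) (by positivity) (by positivity) hσ₀.le
    hX0 hl2 ht1 hlt ?_ ?_
  · rw [Real.sq_sqrt hT0.le]
    have h1 := mul_le_mul_of_nonneg_left (by linarith : (1 : ℝ) ≤ T) hS₀.le
    linarith
  · have h1 := mul_le_mul_of_nonneg_left hroot hC₁
    have h2 : 2 * (driftConst L a σ₀ S₀ * √m) ≤ 4 * driftConst L a σ₀ S₀ * l * √m := by
      have h3 : 0 ≤ driftConst L a σ₀ S₀ * √m := by positivity
      have h4 := mul_le_mul_of_nonneg_right hl2 h3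
      linarith
    linarith

end AdaGradRun

/-! ### Smooth nonnegative objectives. -/

namespace IsSmoothObjective

variable {d : ℕ} {g : EuclideanSpace ℝ (Fin d) → ℝ} {L : ℝ}

theorem mono (h : IsSmoothObjective g L) {L' : ℝ} (hL : L ≤ L') : IsSmoothObjective g L' :=
  ⟨h.contDiff, h.nonneg, fun θ θ' => (h.lipschitz θ θ').trans
    (mul_le_mul_of_nonneg_right hL (norm_nonneg _))⟩

theorem continuous_gradient (h : IsSmoothObjective g L) : Continuous (gradient g) :=
  (LipschitzWith.of_dist_le_mul (K := L.toNNReal) fun θ θ' => by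
    rw [dist_eq_norm, dist_eq_norm]
    exact (h.lipschitz θ θ').trans
      (mul_le_mul_of_nonneg_right (Real.le_coe_toNNReal L) (norm_nonneg _))).continuous

/-- The quadratic upper bound for a function with Lipschitz gradient. -/
theorem le_add_inner_add_sq (h : IsSmoothObjective g L) (x u : EuclideanSpace ℝ (Fin d)) :
    g (x + u) ≤ g x + ⟪gradient g x, u⟫ + L / 2 * ‖u‖ ^ 2 := by
  have hd : ∀ t : ℝ, HasDerivAt
      (fun t : ℝ => g (x + t • u) - t * ⟪gradient g x, u⟫ - L / 2 * ‖u‖ ^ 2 * t ^ 2)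
      (⟪gradient g (x + t • u), u⟫ - ⟪gradient g x, u⟫ - L / 2 * ‖u‖ ^ 2 * (2 * t)) t := by
    intro t
    have h1 : HasDerivAt (fun t : ℝ => x + t • u) u t := by
      simpa using ((hasDerivAt_id t).smul_const u).const_add x
    have h2 := ((h.contDiff.differentiable one_ne_zero) (x + t • u)).hasGradientAt.hasFDerivAt
    have h3 := h2.comp_hasDerivAt t h1
    have h4 : HasDerivAt (fun t : ℝ => g (x + t • u)) ⟪gradient g (x + t • u), u⟫ t := h3
    have h5 := (hasDerivAt_id t).mul_const ⟪gradient g x, u⟫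
    have h6 := (hasDerivAt_pow 2 t).const_mul (L / 2 * ‖u‖ ^ 2)
    refine ((h4.sub h5).sub h6).congr_deriv ?_
    simp
  have hanti : AntitoneOn
      (fun t : ℝ => g (x + t • u) - t * ⟪gradient g x, u⟫ - L / 2 * ‖u‖ ^ 2 * t ^ 2)
      (Set.Icc 0 1) := by
    refine antitoneOn_of_deriv_nonpos (convex_Icc 0 1)
      (fun t _ => (hd t).continuousAt.continuousWithinAt)
      (fun t _ => (hd t).differentiableAt.differentiableWithinAt) fun t ht => ?_
    rw [interior_Icc] at ht
    rw [(hd t).deriv, ← inner_sub_left]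
    have h1 := real_inner_le_norm (gradient g (x + t • u) - gradient g x) u
    have h2 := h.lipschitz (x + t • u) x
    rw [add_sub_cancel_left, norm_smul, Real.norm_of_nonneg ht.1.le] at h2
    have h3 := mul_le_mul_of_nonneg_right h2 (norm_nonneg u)
    linarith
  have := hanti (Set.left_mem_Icc.mpr zero_le_one) (Set.right_mem_Icc.mpr zero_le_one) zero_le_one
  simp only [one_smul, zero_smul, add_zero] at this
  linarith

/-- A gradient step of size `1 / L` lowers `g` by at least ‖∇g‖²/(2L), and the value reached is
still nonnegative. -/
theorem norm_gradient_sq_le (h : IsSmoothObjective g L) (hL : 0 < L)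
    (x : EuclideanSpace ℝ (Fin d)) : ‖gradient g x‖ ^ 2 ≤ 2 * L * g x := by
  have h1 := h.le_add_inner_add_sq x (-(1 / L) • gradient g x)
  have h2 := h.nonneg (x + -(1 / L) • gradient g x)
  rw [inner_smul_right, real_inner_self_eq_norm_sq, norm_smul, mul_pow, Real.norm_eq_abs, sq_abs]
    at h1
  have h3 : 0 ≤ g x - 1 / (2 * L) * ‖gradient g x‖ ^ 2 := by
    have e : L / 2 * ((-(1 / L)) ^ 2 * ‖gradient g x‖ ^ 2)
        = 1 / (2 * L) * ‖gradient g x‖ ^ 2 := by field_simp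
    have e' : -(1 / L) * ‖gradient g x‖ ^ 2 = -2 * (1 / (2 * L) * ‖gradient g x‖ ^ 2) := by
      field_simp
    linarith
  have h4 := mul_le_mul_of_nonneg_left h3 (by positivity : 0 ≤ 2 * L)
  have e : 2 * L * (1 / (2 * L) * ‖gradient g x‖ ^ 2) = ‖gradient g x‖ ^ 2 := by field_simp
  linarith

end IsSmoothObjective

/-! ### The noise filtration and adaptedness of the iterates. -/

section NoiseFiltration

variable {Ω Ξ : Type*} [mΩ : MeasurableSpace Ω] [MeasurableSpace Ξ] {ξ : ℕ → Ω → Ξ}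

/-- The filtration generated by the noise. -/
def noiseFiltration (ξ : ℕ → Ω → Ξ) (hξ : ∀ n, 1 ≤ n → Measurable (ξ n)) : Filtration ℕ mΩ where
  seq := noiseHistory ξ
  mono' _ _ hmn := biSup_mono fun _ hk => ⟨hk.1, hk.2.trans hmn⟩
  le' _ := iSup₂_le fun k hk => (hξ k hk.1).comap_le

omit mΩ in
theorem measurable_noise_of_noiseHistory {k n : ℕ} (hk : 1 ≤ k) (hkn : k ≤ n) :
    Measurable[noiseHistory ξ n] (ξ k) :=
  Measurable.of_comap_le (le_iSup₂ (f := fun k (_ : k ∈ Set.Icc 1 n) =>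
    MeasurableSpace.comap (ξ k) inferInstance) k ⟨hk, hkn⟩)

theorem measurable_adaGradState {d : ℕ}
    {G : EuclideanSpace ℝ (Fin d) → Ξ → EuclideanSpace ℝ (Fin d)}
    (hG : Measurable (Function.uncurry G)) (hξ : ∀ n, 1 ≤ n → Measurable (ξ n)) (α₀ S₀ : ℝ)
    (θ₁ : EuclideanSpace ℝ (Fin d)) (n : ℕ) :
    Measurable[noiseFiltration ξ hξ n]
      (fun ω => adaGradState G α₀ S₀ θ₁ (fun k => ξ k ω) n) := by
  induction n with
  | zero => exact measurable_const
  | succ n ih =>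
    have ih' := ih.mono ((noiseFiltration ξ hξ).mono n.le_succ) le_rfl
    have hξ' : Measurable[noiseFiltration ξ hξ (n + 1)] (ξ (n + 1)) :=
      measurable_noise_of_noiseHistory (by omega) le_rfl
    have h1 := hG.comp (ih'.fst.prodMk hξ')
    have h2 := ih'.snd.add ((continuous_norm.measurable.comp h1).pow_const 2)
    exact (ih'.fst.sub ((measurable_const.div (Real.continuous_sqrt.measurable.comp h2)).smul h1)).prodMk h2

end NoiseFiltration

/-! ### From the vector algorithm to its scalar run. -/

section Link

variable {d : ℕ} {Ω Ξ : Type*} [mΩ : MeasurableSpace Ω] [MeasurableSpace Ξ] {μ : Measure Ω}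
  {g : EuclideanSpace ℝ (Fin d) → ℝ} {G : EuclideanSpace ℝ (Fin d) → Ξ → EuclideanSpace ℝ (Fin d)}
  {ξ : ℕ → Ω → Ξ} {α₀ S₀ : ℝ} {θ₁ : EuclideanSpace ℝ (Fin d)} {σ₀ σ₁ : ℝ}

theorem IsAffineNoiseOracle.mono (h : IsAffineNoiseOracle μ g G ξ α₀ S₀ θ₁ σ₀ σ₁) {σ₀' σ₁' : ℝ}
    (h₀ : σ₀ ≤ σ₀') (h₁ : σ₁ ≤ σ₁') : IsAffineNoiseOracle μ g G ξ α₀ S₀ θ₁ σ₀' σ₁' where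
  measurable_oracle := h.measurable_oracle
  measurable_noise := h.measurable_noise
  indep_noise := h.indep_noise
  memLp := h.memLp
  unbiased := h.unbiased
  affine_variance n hn := by
    filter_upwards [h.affine_variance n hn] with ω hω
    refine hω.trans ?_
    gcongr

omit [MeasurableSpace Ξ] in
theorem le_adaGradState_snd (S₀ : ℝ) (x : ℕ → Ξ) (n : ℕ) :
    S₀ ≤ (adaGradState G α₀ S₀ θ₁ x n).2 := by
  induction n with
  | zero => exact le_rfl
  | succ n ih => exact ih.trans (le_add_of_nonneg_right (sq_nonneg _))

/-- AdaGrad-Norm with an affine noise oracle yields an `AdaGradRun`. -/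
theorem IsAffineNoiseOracle.adaGradRun [IsProbabilityMeasure μ] {L : ℝ}
    (hg : IsSmoothObjective g L) (h : IsAffineNoiseOracle μ g G ξ α₀ S₀ θ₁ σ₀ σ₁) (hL : 0 < L)
    (hα₀ : 0 < α₀) (hσ₀ : 0 < σ₀) (hσ₁ : 0 < σ₁) (hS₀ : 0 < S₀) :
    AdaGradRun μ (noiseFiltration ξ h.measurable_noise) L α₀ σ₀ σ₁ S₀ (g θ₁)
      -- Index `n` of the run is iteration `n + 1`; the accumulator keeps its index, so `s n` is its
      -- value before that iteration and is known at time `n`.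
      (fun n ω => g (adaGradIter G α₀ S₀ θ₁ (fun k => ξ k ω) (n + 1)))
      (fun n ω => ‖gradient g (adaGradIter G α₀ S₀ θ₁ (fun k => ξ k ω) (n + 1))‖)
      (fun n ω => ‖G (adaGradIter G α₀ S₀ θ₁ (fun k => ξ k ω) (n + 1)) (ξ (n + 1) ω)‖)
      (fun n ω => ⟪gradient g (adaGradIter G α₀ S₀ θ₁ (fun k => ξ k ω) (n + 1)),
        G (adaGradIter G α₀ S₀ θ₁ (fun k => ξ k ω) (n + 1)) (ξ (n + 1) ω)⟫)
      (fun n ω => adaGradAcc G α₀ S₀ θ₁ (fun k => ξ k ω) n) := by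
  set ℱ := noiseFiltration ξ h.measurable_noise with hℱ
  set θ : ℕ → Ω → EuclideanSpace ℝ (Fin d) :=
    fun n ω => adaGradIter G α₀ S₀ θ₁ (fun k => ξ k ω) (n + 1) with hθ
  set Γ : ℕ → Ω → EuclideanSpace ℝ (Fin d) := fun n ω => G (θ n ω) (ξ (n + 1) ω) with hΓ
  set S : ℕ → Ω → ℝ := fun n ω => adaGradAcc G α₀ S₀ θ₁ (fun k => ξ k ω) n with hS
  have mstate := measurable_adaGradState h.measurable_oracle h.measurable_noise α₀ S₀ θ₁
  have mθ : ∀ n, Measurable[ℱ n] (θ n) := fun n => (mstate n).fst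
  have mS : ∀ n, Measurable[ℱ n] (S n) := fun n => (mstate n).snd
  have mΓ : ∀ n, Measurable[ℱ (n + 1)] (Γ n) := fun n =>
    h.measurable_oracle.comp (((mθ n).mono (ℱ.mono n.le_succ) le_rfl).prodMk
      (measurable_noise_of_noiseHistory (by omega) le_rfl))
  have mv : ∀ n, Measurable[ℱ n] (fun ω => gradient g (θ n ω)) := fun n =>
    hg.continuous_gradient.measurable.comp (mθ n)
  have Spos : ∀ n ω, 0 < S n ω := fun n ω => hS₀.trans_le (le_adaGradState_snd S₀ _ n)
  have Ssucc : ∀ n ω, S (n + 1) ω = S n ω + ‖Γ n ω‖ ^ 2 := fun n ω => rfl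
  have θsucc : ∀ n ω, θ (n + 1) ω = θ n ω + (-(α₀ / √(S (n + 1) ω))) • Γ n ω := fun n ω => by
    rw [neg_smul, ← sub_eq_add_neg]; rfl
  have step_norm : ∀ n ω, ‖(-(α₀ / √(S (n + 1) ω))) • Γ n ω‖
      = α₀ * (‖Γ n ω‖ / √(S (n + 1) ω)) := fun n ω => by
    rw [norm_smul, norm_neg, Real.norm_of_nonneg (by positivity)]; ring
  have Γ_le : ∀ n ω, ‖Γ n ω‖ / √(S (n + 1) ω) ≤ 1 := fun n ω => by
    rw [div_le_one (Real.sqrt_pos.mpr (Spos _ ω))]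
    refine Real.le_sqrt_of_sq_le ?_
    rw [Ssucc]
    linarith [Spos n ω]
  have LΓ : ∀ n, MemLp (Γ n) 2 μ := fun n => h.memLp (n + 1) (by omega)
  have hunb : ∀ n, μ[Γ n | ℱ n] =ᵐ[μ] fun ω => gradient g (θ n ω) :=
    fun n => h.unbiased (n + 1) (by omega)
  have Lv : ∀ n, MemLp (fun ω => gradient g (θ n ω)) 2 μ :=
    -- The true gradient inherits square-integrability as a conditional expectation.
    fun n => ((LΓ n).condExp one_le_two).ae_eq (hunb n)
  exact {
    L_pos := hL
    a_pos := hα₀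
    σ₀_pos := hσ₀
    σ₁_pos := hσ₁
    S₀_pos := hS₀
    meas_f := fun n => (hg.contDiff.continuous.measurable.comp (mθ n)).stronglyMeasurable
    meas_V := fun n => (continuous_norm.measurable.comp (mv n)).stronglyMeasurable
    meas_s := fun n => (mS n).stronglyMeasurable
    meas_γ := fun n => (continuous_norm.measurable.comp (mΓ n)).stronglyMeasurable
    meas_c := fun n =>
      (((mv n).mono (ℱ.mono n.le_succ) le_rfl).inner (mΓ n)).stronglyMeasurable
    f_zero := fun ω => rfl
    f_nonneg := fun n ω => hg.nonneg _
    V_nonneg := fun n ω => norm_nonneg _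
    γ_nonneg := fun n ω => norm_nonneg _
    V_sq_le := fun n ω => hg.norm_gradient_sq_le hL _
    abs_c_le := fun n ω => abs_real_inner_le_norm _ _
    s_zero := fun ω => rfl
    s_succ := Ssucc
    descent := fun n ω => by
      have h1 := hg.le_add_inner_add_sq (θ n ω) ((-(α₀ / √(S (n + 1) ω))) • Γ n ω)
      rw [← θsucc, step_norm, inner_smul_right, mul_pow, div_pow,
        Real.sq_sqrt (Spos _ ω).le] at h1
      refine h1.trans (le_of_eq ?_)
      ring
    ascent := fun n ω => by
      -- The quadratic bound is based at the new point and run along the reversed step.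
      have h1 := hg.le_add_inner_add_sq (θ (n + 1) ω) (-((-(α₀ / √(S (n + 1) ω))) • Γ n ω))
      have e : θ (n + 1) ω + -((-(α₀ / √(S (n + 1) ω))) • Γ n ω) = θ n ω := by
        rw [θsucc, add_neg_cancel_right]
      have h2 := real_inner_le_norm (gradient g (θ (n + 1) ω))
        (-((-(α₀ / √(S (n + 1) ω))) • Γ n ω))
      have h0 : α₀ * (‖Γ n ω‖ / √(S (n + 1) ω)) ≤ α₀ := mul_le_of_le_one_right hα₀.le (Γ_le n ω)
      rw [e, norm_neg, step_norm] at h1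
      rw [norm_neg, step_norm] at h2
      have h3 := mul_le_mul_of_nonneg_left h0 (norm_nonneg (gradient g (θ (n + 1) ω)))
      have h4 := mul_le_mul_of_nonneg_left (pow_le_pow_left₀ (by positivity) h0 2)
        (by positivity : 0 ≤ L / 2)
      change g (θ n ω) ≤ g (θ (n + 1) ω) + α₀ * ‖gradient g (θ (n + 1) ω)‖ + L / 2 * α₀ ^ 2
      linarith
    V_step := fun n ω => by
      refine (abs_norm_sub_norm_le _ _).trans ((hg.lipschitz _ _).trans ?_)
      change L * ‖θ (n + 1) ω - θ n ω‖ ≤ _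
      rw [θsucc, add_sub_cancel_left, step_norm, mul_assoc]
    memLp_γ := fun n => (LΓ n).norm
    condExp_c := fun n => by
      have i : Integrable (fun ω => ⟪gradient g (θ n ω), Γ n ω⟫) μ := by
        refine ((Lv n).norm.integrable_mul (LΓ n).norm).mono'
          (((Lv n).1).inner (LΓ n).1) (ae_of_all _ fun ω => ?_)
        exact norm_inner_le_norm _ _
      have h1 := condExp_bilin_of_stronglyMeasurable_left (μ := μ) (innerSL ℝ)
        (mv n).stronglyMeasurable i ((LΓ n).integrable one_le_two)
      filter_upwards [h1, hunb n] with ω h1 h2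
      refine h1.trans ?_
      rw [h2]
      exact real_inner_self_eq_norm_sq (gradient g (θ n ω))
    condExp_γ_sq := fun n => h.affine_variance (n + 1) (by omega) }

end Link

/-! ### From expectation to high probability. -/

theorem sum_Icc_one_eq_sum_range (F : ℕ → ℝ) (T : ℕ) :
    ∑ n ∈ Finset.Icc 1 T, F n = ∑ n ∈ Finset.range T, F (n + 1) := by
  induction T with
  | zero => simp
  | succ n ih => rw [Finset.sum_Icc_succ_top (by omega), Finset.sum_range_succ, ih]

theorem corollary4p1 (L σ₀ σ₁ α₀ S₀ g₁ : ℝ) (hL : 0 ≤ L) (hσ₀ : 0 ≤ σ₀) (hσ₁ : 0 ≤ σ₁)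
    (hα₀ : 0 < α₀) (hS₀ : 0 < S₀) :
    ∃ C : ℝ, 0 < C ∧
      ∀ (d : ℕ) (Ω Ξ : Type*) [MeasurableSpace Ω] [MeasurableSpace Ξ]
        (μ : Measure Ω) [IsProbabilityMeasure μ]
        (g : EuclideanSpace ℝ (Fin d) → ℝ)
        (G : EuclideanSpace ℝ (Fin d) → Ξ → EuclideanSpace ℝ (Fin d))
        (ξ : ℕ → Ω → Ξ) (θ₁ : EuclideanSpace ℝ (Fin d)),
        IsSmoothObjective g L →
        IsAffineNoiseOracle μ g G ξ α₀ S₀ θ₁ σ₀ σ₁ →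
        g θ₁ = g₁ →
        ∀ (T : ℕ) (hT : 2 ≤ T) (δ : ℝ), 0 < δ → δ < 1 →
          1 - δ ≤ μ.real {ω |
            (1 / (T : ℝ)) * ∑ n ∈ Finset.Icc 1 T,
                ‖gradient g (adaGradIter G α₀ S₀ θ₁ (fun k => ξ k ω) n)‖ ^ 2
              ≤ C * ((1 / δ) * (Real.log T / √(T : ℝ)))
            ∧ (Finset.Icc 1 T).inf' (Finset.nonempty_Icc.mpr (by omega))
                (fun n => ‖gradient g (adaGradIter G α₀ S₀ θ₁ (fun k => ξ k ω) n)‖ ^ 2)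
              ≤ C * ((1 / δ) * (Real.log T / √(T : ℝ)))} := by

  -- A negative initial value admits no nonnegative objective, so any constant serves.
  rcases lt_or_ge g₁ 0 with hg₁ | hg₁
  · refine ⟨1, one_pos, fun d Ω Ξ _ _ μ _ g G ξ θ₁ hg h e => ?_⟩
    exact absurd (hg.nonneg θ₁) (by linarith)
  -- The smoothness and noise constants may vanish; enlarging each by 1 weakens the assumptions and
  -- makes them strictly positive.
  obtain ⟨C, hC, hsum⟩ := AdaGradRun.exists_sum_integral_V_sq_le (L := L + 1) (a := α₀)
    (σ₀ := σ₀ + 1) (σ₁ := σ₁ + 1) (S₀ := S₀) (g₁ := g₁) (by linarith) hα₀ (by linarith)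
    (by linarith) hS₀ hg₁
  refine ⟨C + 1, by linarith, fun d Ω Ξ _ _ μ _ g G ξ θ₁ hg h e T hT δ hδ hδ1 => ?_⟩
  have hP := (h.mono (le_add_of_nonneg_right zero_le_one)
    (le_add_of_nonneg_right zero_le_one)).adaGradRun
    (hg.mono (L' := L + 1) (by linarith)) (by linarith) hα₀ (by linarith) (by linarith) hS₀
  rw [e] at hP
  have hX := hsum hP T hT
  have hT0 : (0 : ℝ) < T := by exact_mod_cast (by omega : 0 < T)
  have hl : 0 < Real.log T := by linarith [half_le_log hT]
  have ht : 0 < √(T : ℝ) := Real.sqrt_pos.mpr hT0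
  set K := (C + 1) * ((1 / δ) * (Real.log T / √(T : ℝ))) with hK
  have hK0 : 0 < K := by positivity
  set avg : Ω → ℝ := fun ω => (1 / (T : ℝ)) * ∑ n ∈ Finset.Icc 1 T,
    ‖gradient g (adaGradIter G α₀ S₀ θ₁ (fun k => ξ k ω) n)‖ ^ 2 with havg
  have havg' : avg = fun ω => (1 / (T : ℝ)) * ∑ n ∈ Finset.range T,
      ‖gradient g (adaGradIter G α₀ S₀ θ₁ (fun k => ξ k ω) (n + 1))‖ ^ 2 := by
    funext ω
    rw [havg]
    simp only [sum_Icc_one_eq_sum_range]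
  have hint : Integrable avg μ := by
    rw [havg']
    exact (integrable_finsetSum _ fun n _ => hP.integrable_V_sq n).const_mul _
  have hmeas : Measurable avg := by
    rw [havg']
    exact (Finset.measurable_sum _ fun n _ =>
      ((hP.meas_V n).mono (Filtration.le _ n)).measurable.pow_const 2).const_mul _
  have hmean : ∫ ω, avg ω ∂μ ≤ δ * K := by
    rw [havg', integral_const_mul, integral_finsetSum _ fun n _ => hP.integrable_V_sq n]
    refine (mul_le_mul_of_nonneg_left hX (by positivity)).trans ?_
    have e1 : δ * K = (C + 1) * (Real.log T / √(T : ℝ)) := by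
      rw [hK]; field_simp
    have e2 : 1 / (T : ℝ) * (C * (√(T : ℝ) * Real.log T)) = C * (Real.log T / √(T : ℝ)) := by
      have : (T : ℝ) = √(T : ℝ) * √(T : ℝ) := (Real.mul_self_sqrt hT0.le).symm
      nth_rw 1 [this]
      field_simp
    rw [e1, e2]
    exact mul_le_mul_of_nonneg_right (by linarith) (by positivity)
  -- Markov's inequality at level `K`, where the mean is at most `δ * K`.
  have hmarkov := mul_meas_ge_le_integral_of_nonneg (μ := μ) (f := avg)
    (ae_of_all _ fun ω => by positivity) hint K
  have htail : μ.real {ω | K ≤ avg ω} ≤ δ := by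
    have : K * μ.real {ω | K ≤ avg ω} ≤ K * δ := by linarith
    exact le_of_mul_le_mul_left this hK0
  have hset : MeasurableSet {ω | K ≤ avg ω} := measurableSet_le measurable_const hmeas
  have hcompl := probReal_compl_eq_one_sub (μ := μ) hset
  refine (by linarith : 1 - δ ≤ μ.real {ω | K ≤ avg ω}ᶜ).trans (measureReal_mono fun ω hω => ?_)
  have hω' : avg ω ≤ K := (not_le.mp (show ¬K ≤ avg ω from hω)).le
  refine ⟨hω', le_trans ?_ hω'⟩
  -- The minimum is at most the average, so the same event serves both claims.
  have hinf := Finset.card_nsmul_le_sum (Finset.Icc 1 T)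
    (fun n => ‖gradient g (adaGradIter G α₀ S₀ θ₁ (fun k => ξ k ω) n)‖ ^ 2)
    ((Finset.Icc 1 T).inf' (Finset.nonempty_Icc.mpr (by omega))
      fun n => ‖gradient g (adaGradIter G α₀ S₀ θ₁ (fun k => ξ k ω) n)‖ ^ 2)
    fun n hn => Finset.inf'_le
      (fun n => ‖gradient g (adaGradIter G α₀ S₀ θ₁ (fun k => ξ k ω) n)‖ ^ 2) hn
  rw [Nat.card_Icc, Nat.add_sub_cancel, nsmul_eq_mul] at hinf
  have h1 := mul_le_mul_of_nonneg_left hinf (by positivity : 0 ≤ 1 / (T : ℝ))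
  rw [← mul_assoc, one_div_mul_cancel hT0.ne', one_mul] at h1
  exact h1
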